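/- Let $r, c$ be non-negative integers, $n = rc$, and let $P, Q$ be standard Young tableaux of rectangular shape with $r$ rows and $c$ columns (each of $1,\dots,n$ occurs once, entries increase along rows and down columns). Let $S = \mathrm{stack}(P,Q)$ be the standard Young tableau with $2r$ rows and $c$ columns obtained by adding $n$ to every entry of $Q$ and placing the result below $P$. For a standard Young tableau $T$ of rectangular shape with $N$ cells, gromotion $\mathcal{G}$ deletes the smallest entry, performs jeu de taquin slides (the smaller of the entries to the right of and below the empty cell slides into it) until the empty cell is the lower right corner, and fills that corner with the largest entry plus $1$; it is iterated without renormalizing the labels. For $i$ at least $1$ and less than the number of rows of $T$, and $1 \le j \le N$, let $\mathrm{prom}_i(T)(j) \in \{1,\dots,N\}$ be the residue modulo $N$ of the entry that slides up into row $i$ (rows numbered from $1$) when $\mathcal{G}^{j}(T)$ is computed from $\mathcal{G}^{j-1}(T)$. Set $\mathrm{prom}_r^{\mathrm{NE}}(S)(j) = \mathrm{prom}_r(S)(j) - n$ for $1 \le j \le n$. Then $\mathrm{prom}_r^{\mathrm{NE}}(S)$ is a permutation of $\{1,\dots,n\}$ in one-line notation, and $$\mathrm{prom}_r^{\mathrm{NE}}(\mathrm{stack}(P,Q))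 = \mathrm{RS}^{-1}(Q^\top, P^\top);$$ that is, it is the unique permutation of $\{1,\dots,n\}$ whose image under the Robinson–Schensted correspondence (row insertion) is $(Q^\top, P^\top)$, with insertion tableau $Q^\top$ and recording tableau $P^\top$, where ${}^\top$ denotes transposition. -/

import Mathlib

namespace PromRS

/-- A standard Young tableau of rectangular shape with `r` rows and `c` columns, in English
notation: each of `1, …, r * c` occurs exactly once, and the entries increase along rows (left to
right) and down columns. Rows and columns are indexed from `0`; by convention `entry` is `0`
outside the rectangle. -/
@[ext]
structure RectSYT (r c : ℕ) where
  entry : ℕ → ℕ → ℕ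
  zeros : ∀ i j, ¬ (i < r ∧ j < c) → entry i j = 0
  bijOn : Set.BijOn (fun p : ℕ × ℕ => entry p.1 p.2) {p | p.1 < r ∧ p.2 < c}
    (Set.Icc 1 (r * c))
  row_strict : ∀ i j₁ j₂, i < r → j₁ < j₂ → j₂ < c → entry i j₁ < entry i j₂
  col_strict : ∀ i₁ i₂ j, i₁ < i₂ → i₂ < r → j < c → entry i₁ j < entry i₂ j

/-- The transpose of a rectangular standard Young tableau. -/
def RectSYT.transpose {r c : ℕ} (T : RectSYT r c) : RectSYT c r where
  entry i j := T.entry j i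
  zeros i j h := T.zeros j i (fun h' => h ⟨h'.2, h'.1⟩)
  bijOn := by
    obtain ⟨hm, hi, hs⟩ := T.bijOn
    refine ⟨?_, ?_, ?_⟩
    · rintro ⟨i, j⟩ ⟨h₁, h₂⟩
      have := @hm (j, i) ⟨h₂, h₁⟩
      rwa [mul_comm] at this
    · rintro ⟨i, j⟩ ⟨h₁, h₂⟩ ⟨i', j'⟩ ⟨h₁', h₂'⟩ h
      have := @hi (j, i) ⟨h₂, h₁⟩ (j', i') ⟨h₂', h₁'⟩ h
      simp only [Prod.mk.injEq] at this ⊢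
      exact this.symm
    · intro x hx
      rw [mul_comm] at hx
      obtain ⟨⟨i, j⟩, ⟨h₁, h₂⟩, h⟩ := hs hx
      exact ⟨(j, i), ⟨h₂, h₁⟩, h⟩
  row_strict i j₁ j₂ hi hj hc := T.col_strict j₁ j₂ i hj hc hi
  col_strict i₁ i₂ j hi hr hj := T.row_strict j i₁ i₂ hj hi hr

/-- `stack P Q` adds `n = r * c` to all entries of `Q` and places the result below `P`. -/
def RectSYT.stack {r c : ℕ} (P Q : RectSYT r c) : RectSYT (2 * r) c where
  entry i j :=
    if i < r then P.entry i j
    else if i < 2 * r ∧ j < c then Q.entry (i - r) j + r * c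
    else 0
  zeros i j h := by
    by_cases hi : i < r
    · simp only [hi, if_true]
      exact P.zeros i j (fun h' => h ⟨by omega, h'.2⟩)
    · simp only [hi, if_false, h]
  bijOn := by
    obtain ⟨pm, pi, ps⟩ := P.bijOn
    obtain ⟨qm, qi, qs⟩ := Q.bijOn
    have hn : 2 * r * c = r * c + r * c := by ring
    have hP : ∀ i j, i < r → j < c → 1 ≤ P.entry i j ∧ P.entry i j ≤ r * c :=
      fun i j h₁ h₂ => @pm (i, j) ⟨h₁, h₂⟩
    have hQ : ∀ i j, i < r → j < c → 1 ≤ Q.entry i j ∧ Q.entry i j ≤ r * c :=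
      fun i j h₁ h₂ => @qm (i, j) ⟨h₁, h₂⟩
    rw [hn]
    refine ⟨?_, ?_, ?_⟩
    · rintro ⟨i, j⟩ ⟨h₁, h₂⟩
      simp only at h₁ h₂
      simp only [Set.mem_Icc, h₁, h₂, and_self, if_true]
      split_ifs with h
      · have := hP i j h h₂
        omega
      · have := hQ (i - r) j (by omega) h₂
        omega
    · rintro ⟨i, j⟩ ⟨h₁, h₂⟩ ⟨i', j'⟩ ⟨h₁', h₂'⟩ h
      simp only at h₁ h₂ h₁' h₂'
      simp only [h₁, h₂, h₁', h₂', and_self, if_true] at h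
      split_ifs at h with a b b
      · exact @pi (i, j) ⟨a, h₂⟩ (i', j') ⟨b, h₂'⟩ h
      · have := hP i j a h₂
        have := hQ (i' - r) j' (by omega) h₂'
        omega
      · have := hP i' j' b h₂'
        have := hQ (i - r) j (by omega) h₂
        omega
      · have := @qi (i - r, j) ⟨by dsimp only; omega, h₂⟩ (i' - r, j')
          ⟨by dsimp only; omega, h₂'⟩ (by dsimp only; omega)
        simp only [Prod.mk.injEq] at this ⊢
        omega
    · rintro x ⟨hx₁, hx₂⟩
      by_cases hx : x ≤ r * c
      · obtain ⟨⟨i, j⟩, ⟨h₁, h₂⟩, h⟩ := ps ⟨hx₁, hx⟩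
        simp only at h₁ h₂ h
        refine ⟨(i, j), ⟨by dsimp only; omega, h₂⟩, ?_⟩
        simp only [h₁, if_true, h]
      · obtain ⟨⟨i, j⟩, ⟨h₁, h₂⟩, h⟩ := qs (show x - r * c ∈ Set.Icc 1 (r * c) by
          simp only [Set.mem_Icc]; omega)
        simp only at h₁ h₂ h
        refine ⟨(i + r, j), ⟨by dsimp only; omega, h₂⟩, ?_⟩
        have h₃ : ¬ (i + r < r) := by omega
        have h₄ : i + r < 2 * r := by omega
        simp only [h₃, h₄, h₂, if_true, if_false, and_self, Nat.add_sub_cancel, h]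
        omega
  row_strict i j₁ j₂ hi hj hc := by
    have hc' : j₁ < c := by omega
    simp only [hi, hc, hc', and_self, if_true]
    split_ifs with h
    · exact P.row_strict i j₁ j₂ h hj hc
    · have := Q.row_strict (i - r) j₁ j₂ (by omega) hj hc
      omega
  col_strict i₁ i₂ j hi hr hj := by
    have hr' : i₁ < 2 * r := by omega
    simp only [hr, hr', hj, and_self, if_true]
    split_ifs with h₁ h₂ h₂
    · exact P.col_strict i₁ i₂ j hi h₂ hj
    · have := (P.bijOn.mapsTo (x := (i₁, j)) ⟨h₁, hj⟩).2
      have := (Q.bijOn.mapsTo (x := (i₂ - r, j)) ⟨by dsimp only; omega, hj⟩).1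
      dsimp only at *
      omega
    · omega
    · have := Q.col_strict (i₁ - r) (i₂ - r) j (by omega) (by omega) hj
      omega

/-! ### Gromotion and promotion permutations

A filling of the `r × c` rectangle is a function `ℕ → ℕ → ℕ` (row, column). -/

/-- One jeu de taquin slide: the next position of the empty cell when it is at `p`. The smaller of
the entries below and to the right of `p` slides into `p`, and the cell it leaves becomes empty.
At the corner `(r - 1, c - 1)` there is no further slide. (Earlier slides have only changed
cells weakly above and to the left of `p`, so the original filling `T` can be consulted
throughout.) -/
def nextCell (r c : ℕ) (T : ℕ → ℕ → ℕ) (p : ℕ × ℕ) : ℕ × ℕ :=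
  if p.1 + 1 < r ∧ (p.2 + 1 < c → T (p.1 + 1) p.2 < T p.1 (p.2 + 1)) then (p.1 + 1, p.2)
  else if p.2 + 1 < c then (p.1, p.2 + 1)
  else p

/-- The successive positions of the empty cell, from the upper left corner `(0, 0)` (the cell of
the smallest entry, which is deleted) to the lower right corner `(r - 1, c - 1)`. -/
def slidePath (r c : ℕ) (T : ℕ → ℕ → ℕ) : List (ℕ × ℕ) :=
  (List.range (r + c - 1)).map fun k => (nextCell r c T)^[k] (0, 0)

/-- Gromotion: delete the smallest entry, rectify by jeu de taquin slides, and fill the vacated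
corner with the next label. (The labels go from `m < ⋯ < m + n - 1` to `m + 1 < ⋯ < m + n`, where
`m = T 0 0` and `n = r * c`.) -/
def gromotion (r c : ℕ) (T : ℕ → ℕ → ℕ) : ℕ → ℕ → ℕ := fun i j =>
  if (i, j) = (r - 1, c - 1) then T 0 0 + r * c
  else if (i, j) ∈ slidePath r c T then
    T (nextCell r c T (i, j)).1 (nextCell r c T (i, j)).2
  else T i j

/-- The entry that slides up into the `i`-th row (rows counted `1, …, r`) when the gromotion of `T`
is computed. With rows indexed from `0`, it slides from row `i` to row `i - 1`, so it is the entry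
of `T` in the first cell of row `i` that the empty cell visits. It exists for `1 ≤ i < r`. -/
def slideInto (r c : ℕ) (T : ℕ → ℕ → ℕ) (i : ℕ) : ℕ :=
  match (slidePath r c T).find? (fun p => p.1 = i) with
  | some p => T p.1 p.2
  | none => 0

/-- The residue of `x ≥ 1` modulo `n`, taken in `{1, …, n}`. -/
def residue (n x : ℕ) : ℕ := (x - 1) % n + 1

/-- The `i`-th promotion permutation of `T` in one-line notation: for `1 ≤ j ≤ n = r * c`,
`prom T i j` is the residue modulo `n`, in `{1, …, n}`, of the entry that slides into row `i` when
the `j`-th gromotion is computed from the `(j - 1)`-st one. (Here `1 ≤ i < r`.) -/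
def RectSYT.prom {r c : ℕ} (T : RectSYT r c) (i j : ℕ) : ℕ :=
  residue (r * c) (slideInto r c ((gromotion r c)^[j - 1] T.entry) i)

/-- For `S` with `2 * r` rows and `c` columns, and `n = r * c`: the list
`j ↦ prom S i j - n` (`1 ≤ j ≤ n`). -/
def RectSYT.promNE {r c : ℕ} (S : RectSYT (2 * r) c) (i j : ℕ) : ℤ :=
  (S.prom i j : ℤ) - ((r * c : ℕ) : ℤ)

/-! ### The Robinson–Schensted correspondence

During the insertion a tableau is the list of its rows. -/

/-- Row insertion of `x` into a row: `x` replaces the first entry greater than `x`, which is bumped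
out; if there is none, then `x` is appended at the end. -/
def rowInsert (x : ℕ) : List ℕ → List ℕ × Option ℕ
  | [] => ([x], none)
  | y :: ys =>
    if x < y then (x :: ys, some y)
    else (y :: (rowInsert x ys).1, (rowInsert x ys).2)

/-- Insertion of `x` into a tableau: bumped entries are inserted into the next row. Also returns
the (`0`-based) index of the row in which the new cell has been created. -/
def tabInsert (x : ℕ) : List (List ℕ) → List (List ℕ) × ℕ
  | [] => ([[x]], 0)
  | row :: rows =>
    match rowInsert x row with
    | (row', none) => (row' :: rows, 0)
    | (row', some y) => (row' :: (tabInsert y rows).1, (tabInsert y rows).2 + 1)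

/-- Put `k` into a new cell at the end of row `i`, starting a new row if all existing rows come
before row `i`. -/
def appendAt (k : ℕ) : ℕ → List (List ℕ) → List (List ℕ)
  | _, [] => [[k]]
  | 0, row :: rows => (row ++ [k]) :: rows
  | i + 1, row :: rows => row :: appendAt k i rows

/-- The rows of the insertion tableau and of the recording tableau of a permutation. The
permutation `σ` of `Fin n` stands for the permutation `j + 1 ↦ σ j + 1` of `{1, …, n}`. -/
def RSRows {n : ℕ} (σ : Equiv.Perm (Fin n)) : List (List ℕ) × List (List ℕ) :=
  (List.finRange n).foldl
    (fun PQ j =>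
      ((tabInsert ((σ j : ℕ) + 1) PQ.1).1,
        appendAt ((j : ℕ) + 1) (tabInsert ((σ j : ℕ) + 1) PQ.1).2 PQ.2))
    ([], [])

/-- The filling with the given rows, with `0` outside its shape. -/
def ofRows (L : List (List ℕ)) : ℕ → ℕ → ℕ := fun i j => (L.getD i []).getD j 0

/-- The Robinson–Schensted correspondence: a permutation is sent to the pair consisting of its
insertion tableau and its recording tableau, as fillings. All entries of a tableau are positive
and its filling is `0` outside its shape, so the filling determines the shape. -/
def RS {n : ℕ} (σ : Equiv.Perm (Fin n)) : (ℕ → ℕ → ℕ) × (ℕ → ℕ → ℕ) :=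
  (ofRows (RSRows σ).1, ofRows (RSRows σ).2)

end PromRS

/-!
Write `n = r * c`. The permutation in question has a direct description: it sends the entry of `P`
in the cell `(i, j)` to the entry of `Q` in the cell `(i, c - 1 - j)` (rows and columns from `0`).
This is `promNE_stack`, and it reduces the theorem to two facts about Robinson–Schensted.

*Insertion.* Insert the letters `Q (i, c - 1 - j)` in the order given by the entries `P (i, j)`.
When the entries of `P` read so far have row lengths `m₀ ≥ m₁ ≥ ⋯`, column `i` of the insertion
tableau consists of the last `mᵢ` entries of row `i` of `Q`, since the next letter of row `i` of
`Q` merely pushes column `i` down by one cell (`rsState_mirror`). So the final pair is `(Qᵀ, Pᵀ)`.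

*Uniqueness.* Robinson–Schensted is injective, as insertion can be undone (`RS_injective`).

*The promotion permutation.* During the first `n` gromotions of `stack P Q`, the entries of `Q`
stay in their columns. Indeed, if `t j` entries of `P` are left in column `j`, they are followed
by the entries of column `j` of `Q`. When the empty cell leaves the entries of `P` at the bottom
of column `j`, the entry below it is always smaller than the entry to its right, so that it slides
straight down through column `j` of `Q`, and `t j` drops by one. In particular the entry that
slides into row `r` is in row `r - t j` of `Q` (`IsStackShape.exists_gromotion`).

It remains to see in which column `t` drops in step `k`: it is the mirror image of the column of
the entry `k` of `P`. In other words, for the rectangle the shape of the entries of `P` left after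
`k` gromotions is the complement of the shape of the entries at most `k`, rotated by 180 degrees.
This is shown with an invariant in the style of Greene's theorem. For an interval of labels,
consider the largest total size of `i` disjoint chains, where a chain is an increasing sequence of
labels in strictly increasing rows. Each single upward slide of a gromotion preserves this number
(`HasChains.lower`, `HasChains.raise`, `hasChains_gromotion_iff`). For the labels greater than `k`
of `P` it is attained by the last `i` columns, and for what is left of them after `k` gromotions by
the first `i` columns; comparing these for all `i` gives the shape (`IsStackShape.eq_card`).
-/

namespace PromRS

/-! ### Chains of labels in increasing rows -/

/-- `HasChains I ρ i N` says that there are `i` disjoint subsequences of `I` (read in increasing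
order), of total size `N`, along each of which the row number `ρ` increases strictly. The
subsequences are the colour classes of a colouring of a subset of `I` by `i` colours. -/
def HasChains {α : Type*} [LinearOrder α] (I : Finset α) (ρ : α → ℤ) (i N : ℕ) : Prop :=
  ∃ (U : Finset α) (col : α → ℕ), U ⊆ I ∧ U.card = N ∧ (∀ u ∈ U, col u < i) ∧
    ∀ a ∈ U, ∀ b ∈ U, a < b → col a = col b → ρ a < ρ b

theorem HasChains.congr {α : Type*} [LinearOrder α] {I : Finset α} {ρ ρ' : α → ℤ} {i N : ℕ}
    (h : HasChains I ρ i N) (hρ : ∀ x ∈ I, ρ x = ρ' x) : HasChains I ρ' i N := by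
  obtain ⟨U, col, hU, hN, hcol, hlt⟩ := h
  refine ⟨U, col, hU, hN, hcol, fun a ha b hb hab hc => ?_⟩
  rw [← hρ a (hU ha), ← hρ b (hU hb)]
  exact hlt a ha b hb hab hc

/-- The rows of `I` bound the total size of `i` chains: each row meets a chain at most once. -/
theorem HasChains.le_sum {α : Type*} [LinearOrder α] {I : Finset α} {ρ : α → ℤ} {i N R : ℕ}
    (h : HasChains I ρ i N) (hρ : ∀ x ∈ I, ∃ a < R, ρ x = (a : ℤ)) :
    N ≤ ∑ a ∈ Finset.range R, min i (I.filter fun x => ρ x = (a : ℤ)).card := by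
  classical
  obtain ⟨U, col, hU, rfl, hcol, hlt⟩ := h
  have hcover : U ⊆ (Finset.range R).biUnion fun a => U.filter fun x => ρ x = (a : ℤ) := by
    intro x hx
    obtain ⟨a, ha, hxa⟩ := hρ x (hU hx)
    simp only [Finset.mem_biUnion, Finset.mem_range, Finset.mem_filter]
    exact ⟨a, ha, hx, hxa⟩
  refine (Finset.card_le_card hcover).trans (Finset.card_biUnion_le.trans
    (Finset.sum_le_sum fun a _ => le_min ?_ ?_))
  · have := Finset.card_le_card_of_injOn (s := U.filter fun x => ρ x = (a : ℤ))
      (t := Finset.range i) col (fun x hx => ?_) (fun x hx y hy hxy => ?_)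
    · simpa using this
    · simp only [Finset.coe_filter, Set.mem_ofPred_eq] at hx
      simpa using hcol x hx.1
    · simp only [Finset.coe_filter, Set.mem_ofPred_eq] at hx hy
      rcases lt_trichotomy x y with hl | hl | hl
      · have := hlt x hx.1 y hy.1 hl hxy
        omega
      · exact hl
      · have := hlt y hy.1 x hx.1 hl hxy.symm
        omega
  · exact Finset.card_le_card (Finset.filter_subset_filter _ hU)

/-- Lowering the row of `x` from `s` to `s - 1` keeps the total size of `i` chains attainable, if
in every interval `[y, x)` that starts in row `s - 1` the row `s` is at least as frequent as the
row `s - 1`. A chain through both `x` and an element `y` of row `s - 1` is repaired by exchanging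
the part of it above row `s - 1` with that of a chain through an element of row `s` in `[y, x)`;
this may produce another such chain, but one with a smaller `y`. -/
theorem HasChains.lower {α : Type*} [LinearOrder α] {I : Finset α} {ρ ρ' : α → ℤ} {i N : ℕ}
    {x : α} {s : ℤ} (hs : ρ x = s) (hs' : ρ' x = s - 1) (hoff : ∀ z, z ≠ x → ρ' z = ρ z)
    (hfreq : ∀ y ∈ I, y < x → ρ y = s - 1 →
      (I.filter fun z => (y ≤ z ∧ z < x) ∧ ρ z = s - 1).card ≤
        (I.filter fun z => (y ≤ z ∧ z < x) ∧ ρ z = s).card)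
    (h : HasChains I ρ i N) : HasChains I ρ' i N := by
  classical
  obtain rfl : ρ' = Function.update ρ x (s - 1) := by
    funext z
    rcases eq_or_ne z x with rfl | hz
    · rw [hs', Function.update_self]
    · rw [hoff z hz, Function.update_of_ne hz]
  obtain ⟨U, col, hU, hN, hcol, hlt⟩ := h
  -- a colouring without a chain through `x` and row `s - 1` needs no repair
  have good : ∀ col : α → ℕ, (∀ u ∈ U, col u < i) →
      (∀ a ∈ U, ∀ b ∈ U, a < b → col a = col b → ρ a < ρ b) →
      (x ∈ U → ¬ ∃ y ∈ U, y < x ∧ col y = col x ∧ ρ y = s - 1) →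
      HasChains I (Function.update ρ x (s - 1)) i N := by
    intro col hcol hlt hno
    refine ⟨U, col, hU, hN, hcol, fun a ha b hb hab hc => ?_⟩
    have h₁ := hlt a ha b hb hab hc
    by_cases hb' : b = x
    · subst hb'
      have h₂ : ρ a ≠ s - 1 := fun h => hno hb ⟨a, ha, hab, hc, h⟩
      rw [Function.update_self, Function.update_of_ne hab.ne]
      omega
    · rw [Function.update_of_ne hb']
      by_cases ha' : a = x
      · subst ha'
        rw [Function.update_self]
        omega
      · rwa [Function.update_of_ne ha']
  by_cases hxU : x ∈ U
  swap
  · exact good col hcol hlt fun h => absurd h hxU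
  -- strong induction on the number of elements below `y`
  suffices key : ∀ m : ℕ, ∀ col : α → ℕ, (∀ u ∈ U, col u < i) →
      (∀ a ∈ U, ∀ b ∈ U, a < b → col a = col b → ρ a < ρ b) →
      ∀ y ∈ U, y < x → col y = col x → ρ y = s - 1 → (I.filter (· < y)).card = m →
      HasChains I (Function.update ρ x (s - 1)) i N by
    by_cases hex : ∃ y ∈ U, y < x ∧ col y = col x ∧ ρ y = s - 1
    · obtain ⟨y, hy, h₁, h₂, h₃⟩ := hex
      exact key _ col hcol hlt y hy h₁ h₂ h₃ rfl
    · exact good col hcol hlt fun _ => hex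
  clear hcol hlt col
  intro m
  induction m using Nat.strong_induction_on with
  | _ m ih =>
  intro col hcol hlt y hy hyx hyc hys hm
  obtain ⟨z, hzI, hyz, hzx, hzs, hz⟩ : ∃ z ∈ I, y ≤ z ∧ z < x ∧ ρ z = s ∧
      ∀ y' ∈ U, z ∈ U → col y' = col z → ρ y' = s - 1 → y' < y := by
    by_contra! hcon
    have hle := hfreq y (hU hy) hyx hys
    choose! g hg using hcon
    have hmaps : ∀ z ∈ I.filter (fun z => (y ≤ z ∧ z < x) ∧ ρ z = s),
        g z ∈ (I.filter fun z => (y ≤ z ∧ z < x) ∧ ρ z = s - 1).erase y := by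
      intro z hz
      simp only [Finset.mem_filter] at hz
      obtain ⟨h₁, h₂, h₃, h₄, h₅⟩ := hg z hz.1 hz.2.1.1 hz.2.1.2 hz.2.2
      simp only [Finset.mem_erase, Finset.mem_filter]
      refine ⟨?_, hU h₁, ⟨h₅, ?_⟩, h₄⟩
      · intro h
        have := hlt z h₂ x hxU hz.2.1.2 (by rw [← h₃, h, hyc])
        omega
      · rcases lt_or_ge (g z) x with h | h
        · exact h
        · have := hlt z h₂ (g z) h₁ (hz.2.1.2.trans_le h) h₃.symm
          omega
    have hinj : Set.InjOn g (I.filter (fun z => (y ≤ z ∧ z < x) ∧ ρ z = s) : Set α) := by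
      intro z hz z' hz' hzz
      simp only [Set.mem_ofPred_eq, Finset.coe_filter] at hz hz'
      obtain ⟨h₁, h₂, h₃, h₄, h₅⟩ := hg z hz.1 hz.2.1.1 hz.2.1.2 hz.2.2
      obtain ⟨h₁', h₂', h₃', h₄', h₅'⟩ := hg z' hz'.1 hz'.2.1.1 hz'.2.1.2 hz'.2.2
      have hc : col z = col z' := by rw [← h₃, ← h₃', hzz]
      rcases lt_trichotomy z z' with h | h | h
      · have := hlt z h₂ z' h₂' h hc
        omega
      · exact h
      · have := hlt z' h₂' z h₂ h hc.symm
        omega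
    have hcard := Finset.card_le_card_of_injOn g hmaps (by simpa using hinj)
    have hmem : y ∈ I.filter fun z => (y ≤ z ∧ z < x) ∧ ρ z = s - 1 := by
      simp only [Finset.mem_filter]
      exact ⟨hU hy, ⟨le_rfl, hyx⟩, hys⟩
    have := Finset.card_erase_lt_of_mem hmem
    omega
  have hyz' : y < z := lt_of_le_of_ne hyz (by rintro rfl; omega)
  by_cases hzU : z ∈ U
  · have hlow : ∀ a ∈ U, ∀ b ∈ U, col a = col b → ρ a ≤ ρ b → a ≤ b := by
      intro a ha b hb hc hab
      by_contra! hba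
      have := hlt b hb a ha hba hc.symm
      omega
    set col' : α → ℕ := fun u => if s ≤ ρ u then Equiv.swap (col x) (col z) (col u) else col u
      with hcol'
    have hcolx : col' x = col z := by simp [hcol', hs]
    have hlt' : ∀ a ∈ U, ∀ b ∈ U, a < b → col' a = col' b → ρ a < ρ b := by
      intro a ha b hb hab hc
      by_cases h₁ : s ≤ ρ a <;> by_cases h₂ : s ≤ ρ b
      · simp only [hcol', h₁, h₂, if_true] at hc
        exact hlt a ha b hb hab ((Equiv.swap _ _).injective hc)
      · exfalso
        simp only [hcol', h₁, h₂, if_true, if_false] at hc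
        by_cases ha₁ : col a = col x
        · rw [ha₁, Equiv.swap_apply_left] at hc
          have hxa := hlow x hxU a ha ha₁.symm (by omega)
          have := hlt z hzU b hb (hzx.trans_le (hxa.trans hab.le)) hc
          omega
        · by_cases ha₂ : col a = col z
          · rw [ha₂, Equiv.swap_apply_right] at hc
            have hza := hlow z hzU a ha ha₂.symm (by omega)
            have := hlt y hy b hb (hyz'.trans_le (hza.trans hab.le)) (hyc.trans hc)
            omega
          · rw [Equiv.swap_apply_of_ne_of_ne ha₁ ha₂] at hc
            have := hlt a ha b hb hab hc
            omega
      · omega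
      · simp only [hcol', h₁, h₂, if_false] at hc
        exact hlt a ha b hb hab hc
    have hcolb : ∀ u ∈ U, col' u < i := by
      intro u hu
      simp only [hcol']
      split_ifs
      · rcases eq_or_ne (col u) (col x) with h | h
        · rw [h, Equiv.swap_apply_left]
          exact hcol z hzU
        · rcases eq_or_ne (col u) (col z) with h' | h'
          · rw [h', Equiv.swap_apply_right]
            exact hcol x hxU
          · rw [Equiv.swap_apply_of_ne_of_ne h h']
            exact hcol u hu
      · exact hcol u hu
    by_cases hex : ∃ y' ∈ U, y' < x ∧ col' y' = col' x ∧ ρ y' = s - 1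
    · obtain ⟨y', hy', h₁, h₂, h₃⟩ := hex
      have h₄ : ¬ s ≤ ρ y' := by omega
      have h₅ : col y' = col z := by
        rw [hcolx] at h₂
        simpa only [hcol', h₄, if_false] using h₂
      have h₆ := hz y' hy' hzU h₅ h₃
      refine ih _ ?_ col' hcolb hlt' y' hy' h₁ h₂ h₃ rfl
      rw [← hm]
      refine Finset.card_lt_card ⟨fun a ha => ?_, fun hsub => ?_⟩
      · simp only [Finset.mem_filter] at ha ⊢
        exact ⟨ha.1, ha.2.trans h₆⟩
      · have : y' ∈ I.filter (· < y') := hsub (by simpa using ⟨hU hy', h₆⟩)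
        simp at this
    · exact good col' hcolb hlt' fun _ => hex
  · -- `z` is not used by any chain and can replace `x`
    refine ⟨insert z (U.erase x), Function.update col z (col x), ?_, ?_, ?_, ?_⟩
    · intro u hu
      rcases Finset.mem_insert.1 hu with rfl | hu
      · exact hzI
      · exact hU (Finset.mem_of_mem_erase hu)
    · rw [Finset.card_insert_of_notMem (fun h => hzU (Finset.mem_of_mem_erase h)),
        Finset.card_erase_add_one hxU, hN]
    · intro u hu
      rcases Finset.mem_insert.1 hu with rfl | hu
      · rw [Function.update_self]
        exact hcol x hxU
      · have hu' := Finset.mem_of_mem_erase hu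
        rw [Function.update_of_ne (by rintro rfl; exact hzU hu')]
        exact hcol u hu'
    · intro a ha b hb hab hc
      have hne : ∀ u ∈ insert z (U.erase x), u ≠ x := by
        intro u hu
        rcases Finset.mem_insert.1 hu with rfl | hu
        · exact hzx.ne
        · exact Finset.ne_of_mem_erase hu
      rw [Function.update_of_ne (hne a ha), Function.update_of_ne (hne b hb)]
      rcases Finset.mem_insert.1 ha with rfl | ha'
      · have hb' : b ∈ U := by
          rcases Finset.mem_insert.1 hb with rfl | hb
          · exact absurd hab (lt_irrefl _)
          · exact Finset.mem_of_mem_erase hb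
        rw [Function.update_self, Function.update_of_ne (by rintro rfl; exact hzU hb')] at hc
        have h₁ := hlt y hy b hb' (hyz'.trans hab) (hyc.trans hc)
        rcases lt_or_gt_of_ne (hne b hb) with h | h
        · have := hlt b hb' x hxU h hc.symm
          omega
        · have := hlt x hxU b hb' h hc
          omega
      · have ha₁ := Finset.mem_of_mem_erase ha'
        have haz : a ≠ z := by rintro rfl; exact hzU ha₁
        rcases Finset.mem_insert.1 hb with rfl | hb'
        · rw [Function.update_self, Function.update_of_ne haz] at hc
          have := hlt a ha₁ x hxU (hab.trans hzx) hc
          omega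
        · have hb₁ := Finset.mem_of_mem_erase hb'
          have hbz : b ≠ z := by rintro rfl; exact hzU hb₁
          rw [Function.update_of_ne haz, Function.update_of_ne hbz] at hc
          exact hlt a ha₁ b hb₁ hab hc

/-- Reversing both the order of the elements and the order of the rows keeps the chains. -/
theorem HasChains.dual {α : Type*} [LinearOrder α] {I : Finset α} {ρ : α → ℤ} {i N : ℕ}
    (h : HasChains I ρ i N) : HasChains (α := αᵒᵈ) I (fun a => -ρ a) i N := by
  obtain ⟨U, col, hU, hN, hcol, hlt⟩ := h
  exact ⟨U, col, hU, hN, hcol, fun a ha b hb hab hc =>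
    neg_lt_neg (hlt b hb a ha hab hc.symm)⟩

/-- The converse of `HasChains.lower`, which follows from it by reversing both orders. -/
theorem HasChains.raise {α : Type*} [LinearOrder α] {I : Finset α} {ρ ρ' : α → ℤ} {i N : ℕ}
    {x : α} {s : ℤ} (hs : ρ x = s) (hs' : ρ' x = s - 1) (hoff : ∀ z, z ≠ x → ρ' z = ρ z)
    (hfreq : ∀ y ∈ I, x < y → ρ y = s →
      (I.filter fun z => (x < z ∧ z ≤ y) ∧ ρ z = s).card ≤
        (I.filter fun z => (x < z ∧ z ≤ y) ∧ ρ z = s - 1).card)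
    (h : HasChains I ρ' i N) : HasChains I ρ i N := by
  have key := HasChains.lower (α := αᵒᵈ) (I := I) (x := x) (s := 1 - s)
    (ρ := fun a => -ρ' a) (ρ' := fun a => -ρ a) (by simp only [hs']; ring)
    (by simp only [hs]; ring) (fun z hz => by simp only [hoff z hz]) ?_ h.dual
  · exact (HasChains.dual (α := αᵒᵈ) key).congr fun z _ => neg_neg _
  · intro (y : α) hy hyx hys
    have hyx' : x < y := hyx
    have hle := hfreq y hy hyx' (by
      simp only [hoff y hyx'.ne'] at hys
      omega)
    have hcard : ∀ e e' : ℤ, e' = -e →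
        (I.filter fun z => (z ≤ y ∧ x < z) ∧ -ρ' z = e').card =
        (I.filter fun z => (x < z ∧ z ≤ y) ∧ ρ z = e).card := by
      rintro e e' rfl
      congr 1
      refine Finset.filter_congr fun z _ => ⟨?_, ?_⟩
      · rintro ⟨⟨h₁, h₂⟩, h₃⟩
        have := hoff z h₂.ne'
        exact ⟨⟨h₂, h₁⟩, by omega⟩
      · rintro ⟨⟨h₁, h₂⟩, h₃⟩
        have := hoff z h₁.ne'
        exact ⟨⟨h₂, h₁⟩, by omega⟩
    have e₁ := hcard s (1 - s - 1) (by ring)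
    have e₂ := hcard (s - 1) (1 - s) (by ring)
    exact (le_of_eq e₁).trans (hle.trans (le_of_eq e₂.symm))

/-! ### Gromotion along the path of the empty cell -/

/-- A standard filling of the `R × C` rectangle by the labels `k + 1, …, k + R * C`. -/
structure IsStd (R C k : ℕ) (F : ℕ → ℕ → ℕ) : Prop where
  inj : ∀ {i j i' j'}, i < R → j < C → i' < R → j' < C → F i j = F i' j' → i = i' ∧ j = j'
  lower : ∀ {i j}, i < R → j < C → k < F i j
  upper : ∀ {i j}, i < R → j < C → F i j ≤ k + R * C
  surj : ∀ v, k < v → v ≤ k + R * C → ∃ i < R, ∃ j < C, F i j = v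
  row_succ : ∀ {i j}, i < R → j + 1 < C → F i j < F i (j + 1)
  col_succ : ∀ {i j}, i + 1 < R → j < C → F i j < F (i + 1) j

namespace IsStd

variable {R C k : ℕ} {F : ℕ → ℕ → ℕ}

theorem row_lt (h : IsStd R C k F) {i j j' : ℕ} (hi : i < R) (hj : j < j') (hj' : j' < C) :
    F i j < F i j' := by
  induction j', hj using Nat.le_induction with
  | base => exact h.row_succ hi hj'
  | succ m _ ih => exact (ih (by omega)).trans (h.row_succ hi hj')

theorem col_lt (h : IsStd R C k F) {i i' j : ℕ} (hi : i < i') (hi' : i' < R) (hj : j < C) :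
    F i j < F i' j := by
  induction i', hi using Nat.le_induction with
  | base => exact h.col_succ hi' hj
  | succ m _ ih => exact (ih (by omega)).trans (h.col_succ hi' hj)

theorem row_le (h : IsStd R C k F) {i j j' : ℕ} (hi : i < R) (hj : j ≤ j') (hj' : j' < C) :
    F i j ≤ F i j' := by
  rcases hj.eq_or_lt with rfl | hj
  · exact le_rfl
  · exact (h.row_lt hi hj hj').le

theorem col_le (h : IsStd R C k F) {i i' j : ℕ} (hi : i ≤ i') (hi' : i' < R) (hj : j < C) :
    F i j ≤ F i' j := by
  rcases hi.eq_or_lt with rfl | hi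
  · exact le_rfl
  · exact (h.col_lt hi hi' hj).le

theorem le (h : IsStd R C k F) {i i' j j' : ℕ} (hi : i ≤ i') (hi' : i' < R) (hj : j ≤ j')
    (hj' : j' < C) : F i j ≤ F i' j' :=
  (h.row_le (hi.trans_lt hi') hj hj').trans (h.col_le hi hi' hj')

theorem entry_zero (h : IsStd R C k F) (hR : 0 < R) (hC : 0 < C) : F 0 0 = k + 1 := by
  obtain ⟨i, hi, j, hj, hv⟩ := h.surj (k + 1) (by omega) (by
    have := Nat.mul_pos hR hC
    omega)
  have h₁ := h.le (Nat.zero_le i) hi (Nat.zero_le j) hj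
  have h₂ := h.lower hR hC
  omega

end IsStd

theorem RectSYT.isStd {r c : ℕ} (T : RectSYT r c) : IsStd r c 0 T.entry where
  inj {i j i' j'} hi hj hi' hj' h := by
    have := T.bijOn.injOn (x₁ := (i, j)) ⟨hi, hj⟩ (x₂ := (i', j')) ⟨hi', hj'⟩ h
    simpa using this
  lower {i j} hi hj := (T.bijOn.mapsTo (x := (i, j)) ⟨hi, hj⟩).1
  upper {i j} hi hj := by
    have := (T.bijOn.mapsTo (x := (i, j)) ⟨hi, hj⟩).2
    dsimp only at this
    omega
  surj v hv hv' := by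
    obtain ⟨⟨i, j⟩, ⟨hi, hj⟩, h⟩ := T.bijOn.surjOn (show v ∈ Set.Icc 1 (r * c) from
      ⟨hv, by omega⟩)
    exact ⟨i, hi, j, hj, h⟩
  row_succ {i j} hi hj := T.row_strict i j (j + 1) hi (by omega) hj
  col_succ {i j} hi hj := T.col_strict i (i + 1) j (by omega) hi hj

/-- The column in which the empty cell enters row `s` (rows counted from `0`) during a gromotion
of `F`. It leaves row `s` in the column in which it enters row `s + 1`, which is the first column
`j` from which the slide goes down; by convention, the last row is left in the last column. -/
noncomputable def entryCol (R C : ℕ) (F : ℕ → ℕ → ℕ) : ℕ → ℕ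
  | 0 => 0
  | s + 1 => sInf {j | entryCol R C F s ≤ j ∧
      (j + 1 < C → s + 1 < R ∧ F (s + 1) j < F s (j + 1))}

section

variable {R C : ℕ} {F : ℕ → ℕ → ℕ}

theorem entryCol_succ_mem (R C : ℕ) (F : ℕ → ℕ → ℕ) (s : ℕ) :
    entryCol R C F s ≤ entryCol R C F (s + 1) ∧ (entryCol R C F (s + 1) + 1 < C →
      s + 1 < R ∧ F (s + 1) (entryCol R C F (s + 1)) < F s (entryCol R C F (s + 1) + 1)) :=
  Nat.sInf_mem (s := {j | entryCol R C F s ≤ j ∧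
      (j + 1 < C → s + 1 < R ∧ F (s + 1) j < F s (j + 1))})
    ⟨max (entryCol R C F s) C, le_max_left _ _, fun h => absurd (le_max_right
      (entryCol R C F s) C) (by omega)⟩

theorem entryCol_le_succ (R C : ℕ) (F : ℕ → ℕ → ℕ) (s : ℕ) :
    entryCol R C F s ≤ entryCol R C F (s + 1) := (entryCol_succ_mem R C F s).1

theorem entryCol_mono (R C : ℕ) (F : ℕ → ℕ → ℕ) : Monotone (entryCol R C F) :=
  monotone_nat_of_le_succ (entryCol_le_succ R C F)

theorem entryCol_lt (hC : 0 < C) (s : ℕ) : entryCol R C F s < C := by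
  induction s with
  | zero => exact hC
  | succ s ih =>
    have : entryCol R C F (s + 1) ≤ C - 1 := Nat.sInf_le ⟨by omega, fun h => by omega⟩
    omega

theorem entryCol_last (hR : 0 < R) (hC : 0 < C) : entryCol R C F R = C - 1 := by
  obtain ⟨s, rfl⟩ : ∃ s, R = s + 1 := ⟨R - 1, by omega⟩
  have h₁ := (entryCol_succ_mem (s + 1) C F s).2
  have h₂ := entryCol_lt (R := s + 1) (F := F) hC (s + 1)
  by_contra h
  exact absurd (h₁ (by omega)).1 (lt_irrefl _)

theorem right_of_lt_entryCol {s j : ℕ} (hj : entryCol R C F s ≤ j)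
    (hj' : j < entryCol R C F (s + 1)) :
    j + 1 < C ∧ ¬ (s + 1 < R ∧ F (s + 1) j < F s (j + 1)) := by
  have := Nat.notMem_of_lt_sInf hj'
  simp only [Set.mem_ofPred_eq, not_and, Classical.not_imp] at this
  obtain ⟨h₁, h₂⟩ := this hj
  exact ⟨h₁, fun h => h₂ h.1 h.2⟩

/-- The empty cell visits exactly the cells of row `s` from column `entryCol R C F s` to column
`entryCol R C F (s + 1)`. -/
theorem iterate_nextCell : ∀ {s j : ℕ}, s < R → entryCol R C F s ≤ j →
    j ≤ entryCol R C F (s + 1) → (nextCell R C F)^[s + j] (0, 0) = (s, j) := by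
  intro s
  induction s with
  | zero =>
    intro j hs _ hj
    induction j with
    | zero => rfl
    | succ j ih =>
      obtain ⟨h₁, h₂⟩ := right_of_lt_entryCol (R := R) (C := C) (F := F) (s := 0)
        (Nat.zero_le j) hj
      rw [← Nat.add_assoc, Function.iterate_succ_apply', ih (Nat.zero_le _) (by omega)]
      simp only [nextCell]
      rw [if_neg (fun h => h₂ ⟨h.1, h.2 h₁⟩), if_pos h₁]
  | succ s ihs =>
    intro j hs hj
    induction j, hj using Nat.le_induction with
    | base =>
      intro _
      have h := entryCol_succ_mem R C F s
      rw [show s + 1 + entryCol R C F (s + 1) = s + entryCol R C F (s + 1) + 1 by ring,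
        Function.iterate_succ_apply', ihs (by omega) h.1 le_rfl]
      simp only [nextCell]
      rw [if_pos ⟨hs, fun h' => (h.2 h').2⟩]
    | succ j hj ih =>
      intro hj'
      obtain ⟨h₁, h₂⟩ := right_of_lt_entryCol hj hj'
      rw [← Nat.add_assoc, Function.iterate_succ_apply', ih (by omega)]
      simp only [nextCell]
      rw [if_neg (fun h => h₂ ⟨h.1, h.2 h₁⟩), if_pos h₁]

/-- Every antidiagonal contains a cell visited by the empty cell. -/
theorem exists_visited (hR : 0 < R) (hC : 0 < C) {m : ℕ} (hm : m < R + C - 1) :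
    ∃ s < R, ∃ j, s + j = m ∧ entryCol R C F s ≤ j ∧ j ≤ entryCol R C F (s + 1) := by
  classical
  have hlast := entryCol_last (F := F) hR hC
  have hex : ∃ s, m < s + entryCol R C F s := ⟨R + m, by
    have := entryCol_lt (R := R) (F := F) hC (R + m)
    omega⟩
  have hR' : m < R + entryCol R C F R := by omega
  have h₁ := Nat.find_spec hex
  have h₂ : Nat.find hex ≤ R := Nat.find_min' hex hR'
  have h₀ : Nat.find hex ≠ 0 := fun h => by
    rw [h] at h₁
    simp [entryCol] at h₁
  obtain ⟨s, hs⟩ := Nat.exists_eq_succ_of_ne_zero h₀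
  have h₃ := Nat.find_min hex (m := s) (by omega)
  rw [hs] at h₁
  refine ⟨s, by omega, m - s, by omega, by omega, ?_⟩
  simp only [Nat.succ_eq_add_one] at h₁
  omega

theorem mem_slidePath (hC : 0 < C) {i j : ℕ} (hi : i < R) (hj : j < C) :
    (i, j) ∈ slidePath R C F ↔ entryCol R C F i ≤ j ∧ j ≤ entryCol R C F (i + 1) := by
  simp only [slidePath, List.mem_map, List.mem_range]
  constructor
  · rintro ⟨m, hm, h⟩
    obtain ⟨s, hs, j', hm', h₁, h₂⟩ := exists_visited (F := F) (by omega) hC hm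
    rw [← hm', iterate_nextCell hs h₁ h₂] at h
    obtain ⟨rfl, rfl⟩ := Prod.mk.injEq .. ▸ h
    exact ⟨h₁, h₂⟩
  · rintro ⟨h₁, h₂⟩
    exact ⟨i + j, by omega, iterate_nextCell hi h₁ h₂⟩

theorem gromotion_corner : gromotion R C F (R - 1) (C - 1) = F 0 0 + R * C := by
  simp [gromotion]

theorem gromotion_right (hC : 0 < C) {i j : ℕ} (hi : i < R) (h₁ : entryCol R C F i ≤ j)
    (h₂ : j < entryCol R C F (i + 1)) : gromotion R C F i j = F i (j + 1) := by
  obtain ⟨h₃, h₄⟩ := right_of_lt_entryCol h₁ h₂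
  have h₅ : (i, j) ∈ slidePath R C F := (mem_slidePath hC hi (by omega)).2 ⟨h₁, h₂.le⟩
  have h₆ : ¬ (i, j) = (R - 1, C - 1) := by
    rw [Prod.mk.injEq]
    omega
  simp only [gromotion]
  rw [if_neg h₆, if_pos h₅]
  simp only [nextCell]
  rw [if_neg (fun h => h₄ ⟨h.1, h.2 h₃⟩), if_pos h₃]

theorem gromotion_down (hC : 0 < C) {i : ℕ} (hi : i + 1 < R) :
    gromotion R C F i (entryCol R C F (i + 1)) = F (i + 1) (entryCol R C F (i + 1)) := by
  have h := entryCol_succ_mem R C F i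
  have h₅ : (i, entryCol R C F (i + 1)) ∈ slidePath R C F :=
    (mem_slidePath hC (by omega) (entryCol_lt hC _)).2 ⟨h.1, le_rfl⟩
  have h₆ : ¬ (i, entryCol R C F (i + 1)) = (R - 1, C - 1) := by
    rw [Prod.mk.injEq]
    omega
  simp only [gromotion]
  rw [if_neg h₆, if_pos h₅]
  simp only [nextCell]
  rw [if_pos ⟨hi, fun h' => (h.2 h').2⟩]

theorem gromotion_off (hR : 0 < R) (hC : 0 < C) {i j : ℕ} (hi : i < R) (hj : j < C)
    (h : ¬ (entryCol R C F i ≤ j ∧ j ≤ entryCol R C F (i + 1))) :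
    gromotion R C F i j = F i j := by
  have h₆ : ¬ (i, j) = (R - 1, C - 1) := by
    rw [Prod.mk.injEq]
    rintro ⟨rfl, rfl⟩
    have h₁ := entryCol_last (F := F) hR hC
    have h₂ := entryCol_lt (R := R) (F := F) hC (R - 1)
    rw [Nat.sub_add_cancel hR] at h
    omega
  simp only [gromotion]
  rw [if_neg h₆, if_neg (fun h' => h ((mem_slidePath hC hi hj).1 h'))]

theorem slideInto_eq (hC : 0 < C) {i : ℕ} (hi : i < R) :
    slideInto R C F i = F i (entryCol R C F i) := by
  have hcell := iterate_nextCell (R := R) (F := F) hi le_rfl (entryCol_le_succ R C F i)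
  have hlt := entryCol_lt (R := R) (F := F) hC i
  suffices h : (slidePath R C F).find? (fun p => p.1 = i) = some (i, entryCol R C F i) by
    simp only [slideInto, h]
  rw [slidePath, List.find?_map, (List.find?_range_eq_some (i := i + entryCol R C F i)).2]
  · simp [hcell]
  · refine ⟨by simp [hcell], by simp only [List.mem_range]; omega, fun m hm => ?_⟩
    obtain ⟨s, hs, j', hm', h₁, h₂⟩ := exists_visited (R := R) (C := C) (F := F) (m := m)
      (by omega) hC (by omega)
    rw [Function.comp, ← hm', iterate_nextCell hs h₁ h₂]
    simp only [Bool.not_eq_true', decide_eq_false_iff_not]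
    rintro rfl
    omega

end

/-- Where the entry of a cell of the gromotion comes from: it has slid from the right or from
below, or it has not moved, or it is new. -/
theorem gromotion_cases {R C : ℕ} (F : ℕ → ℕ → ℕ) (hR : 0 < R) (hC : 0 < C) {i j : ℕ}
    (hi : i < R) (hj : j < C) :
    (entryCol R C F i ≤ j ∧ j < entryCol R C F (i + 1) ∧ j + 1 < C ∧
      ¬ (i + 1 < R ∧ F (i + 1) j < F i (j + 1)) ∧ gromotion R C F i j = F i (j + 1)) ∨
    (i + 1 < R ∧ j = entryCol R C F (i + 1) ∧ (j + 1 < C → F (i + 1) j < F i (j + 1)) ∧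
      gromotion R C F i j = F (i + 1) j) ∨
    (i + 1 = R ∧ j + 1 = C ∧ gromotion R C F i j = F 0 0 + R * C) ∨
    (¬ (entryCol R C F i ≤ j ∧ j ≤ entryCol R C F (i + 1)) ∧ gromotion R C F i j = F i j) := by
  by_cases h : entryCol R C F i ≤ j ∧ j ≤ entryCol R C F (i + 1)
  · rcases h.2.lt_or_eq with h' | rfl
    · obtain ⟨h₁, h₂⟩ := right_of_lt_entryCol h.1 h'
      exact Or.inl ⟨h.1, h', h₁, h₂, gromotion_right hC hi h.1 h'⟩
    · by_cases hi' : i + 1 < R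
      · exact Or.inr (Or.inl ⟨hi', rfl, fun h' => ((entryCol_succ_mem R C F i).2 h').2,
          gromotion_down hC hi'⟩)
      · have h₁ : i + 1 = R := by omega
        have h₂ := entryCol_last (F := F) hR hC
        have h₃ : i = R - 1 := by omega
        refine Or.inr (Or.inr (Or.inl ⟨h₁, by rw [h₁]; omega, ?_⟩))
        rw [h₁, h₂, h₃, gromotion_corner]
  · exact Or.inr (Or.inr (Or.inr ⟨h, gromotion_off hR hC hi hj h⟩))

/-- Gromotion of a standard filling is standard. -/
theorem IsStd.gromotion {R C k : ℕ} {F : ℕ → ℕ → ℕ} (h : IsStd R C k F) (hR : 0 < R)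
    (hC : 0 < C) : IsStd R C (k + 1) (gromotion R C F) := by
  have h0 := h.entry_zero hR hC
  have e0 : entryCol R C F 0 = 0 := rfl
  have hmono := entryCol_mono R C F
  have hRC := Nat.mul_pos hR hC
  -- the entries of the gromotion are the new label and old entries outside the cell `(0, 0)`
  have hold : ∀ {i j}, i < R → j < C →
      (i + 1 = R ∧ j + 1 = C ∧ PromRS.gromotion R C F i j = k + 1 + R * C) ∨
      ∃ i' < R, ∃ j' < C, PromRS.gromotion R C F i j = F i' j' ∧ (i', j') ≠ (0, 0) := by
    intro i j hi hj
    rcases gromotion_cases F hR hC hi hj with ⟨h₁, h₂, h₃, h₄, h₅⟩ | ⟨h₁, h₂, h₃, h₄⟩ |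
      ⟨h₁, h₂, h₃⟩ | ⟨h₁, h₂⟩
    · exact Or.inr ⟨i, hi, j + 1, h₃, h₅, by simp⟩
    · exact Or.inr ⟨i + 1, h₁, j, hj, h₄, by simp⟩
    · exact Or.inl ⟨h₁, h₂, by rw [h₃, h0]⟩
    · refine Or.inr ⟨i, hi, j, hj, h₂, ?_⟩
      rintro ⟨⟩
      exact h₁ ⟨by omega, Nat.zero_le _⟩
  have hsurj : ∀ v, k + 1 < v → v ≤ k + 1 + R * C →
      ∃ i < R, ∃ j < C, PromRS.gromotion R C F i j = v := by
    intro v hv hv'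
    rcases hv'.eq_or_lt with rfl | hv'
    · exact ⟨R - 1, by omega, C - 1, by omega, by rw [gromotion_corner, h0]⟩
    · obtain ⟨i, hi, j, hj, rfl⟩ := h.surj v (by omega) (by omega)
      by_cases hon : entryCol R C F i ≤ j ∧ j ≤ entryCol R C F (i + 1)
      · rcases hon.1.lt_or_eq with h' | h'
        · refine ⟨i, hi, j - 1, by omega, ?_⟩
          rw [gromotion_right hC hi (by omega) (by omega), Nat.sub_add_cancel (by omega)]
        · rcases Nat.eq_zero_or_pos i with rfl | hi0
          · rw [← h', e0, h0] at hv
            omega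
          · refine ⟨i - 1, by omega, j, hj, ?_⟩
            have := gromotion_down (F := F) (R := R) hC (i := i - 1) (by omega)
            rwa [Nat.sub_add_cancel hi0, h'] at this
      · exact ⟨i, hi, j, hj, gromotion_off hR hC hi hj hon⟩
  have hbd : ∀ {i j}, i < R → j < C → k + 1 < PromRS.gromotion R C F i j ∧
      PromRS.gromotion R C F i j ≤ k + 1 + R * C := by
    intro i j hi hj
    rcases hold hi hj with ⟨-, -, h₁⟩ | ⟨i', hi', j', hj', h₁, h₂⟩
    · omega
    · have h₃ := h.lower hi' hj'
      have h₄ := h.upper hi' hj'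
      have h₅ : F i' j' ≠ k + 1 := fun h₅ => by
        have := h.inj hi' hj' hR hC (h₅.trans h0.symm)
        exact h₂ (by rw [this.1, this.2])
      omega
  refine ⟨?_, fun hi hj => (hbd hi hj).1, fun hi hj => (hbd hi hj).2, hsurj, ?_, ?_⟩
  · -- a surjection between finite sets of the same size is injective
    have hcard : (Finset.Icc (k + 2) (k + 1 + R * C)).card =
        (Finset.range R ×ˢ Finset.range C).card := by
      simp
    have := Finset.injOn_of_surjOn_of_card_le (s := Finset.range R ×ˢ Finset.range C)
      (t := Finset.Icc (k + 2) (k + 1 + R * C))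
      (fun p => PromRS.gromotion R C F p.1 p.2) (fun p hp => ?_) (fun v hv => ?_) (by omega)
    · intro i j i' j' hi hj hi' hj' heq
      have := @this (i, j) (by simp [hi, hj]) (i', j') (by simp [hi', hj']) heq
      simpa using this
    · simp only [Finset.coe_product, Set.mem_prod, Finset.mem_coe, Finset.mem_range] at hp
      have := hbd hp.1 hp.2
      simp only [Finset.coe_Icc, Set.mem_Icc]
      omega
    · simp only [Finset.coe_Icc, Set.mem_Icc] at hv
      obtain ⟨i, hi, j, hj, h⟩ := hsurj v (by omega) hv.2
      exact ⟨(i, j), by simp [hi, hj], h⟩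
  · intro i j hi hj
    rcases gromotion_cases F hR hC hi (show j < C by omega) with ⟨h₁, h₂, h₃, h₄, h₅⟩ |
      ⟨h₁, h₂, h₃, h₄⟩ | ⟨h₁, h₂, h₃⟩ | ⟨h₁, h₂⟩ <;>
    rcases gromotion_cases F hR hC hi hj with ⟨g₁, g₂, g₃, g₄, g₅⟩ |
      ⟨g₁, g₂, g₃, g₄⟩ | ⟨g₁, g₂, g₃⟩ | ⟨g₁, g₂⟩
    · rw [h₅, g₅]; exact h.row_succ hi g₃
    · rw [h₅, g₄]; exact h.col_succ g₁ hj
    · rw [h₅, g₃, h0]; have := h.upper hi hj; omega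
    · omega
    · omega
    · omega
    · omega
    · rw [h₄, g₂]; exact h₃ hj
    · omega
    · omega
    · omega
    · omega
    · rw [h₂, g₅]
      exact (h.row_succ hi hj).trans (h.row_succ hi g₃)
    · rw [h₂, g₄]
      exact (h.row_succ hi hj).trans (h.col_succ g₁ hj)
    · rw [h₂, g₃, h0]; have := h.upper hi (show j < C by omega); omega
    · rw [h₂, g₂]; exact h.row_succ hi hj
  · intro i j hi hj
    have hi' : i < R := by omega
    rcases gromotion_cases F hR hC hi' hj with ⟨h₁, h₂, h₃, h₄, h₅⟩ |
      ⟨h₁, h₂, h₃, h₄⟩ | ⟨h₁, h₂, h₃⟩ | ⟨h₁, h₂⟩ <;>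
    rcases gromotion_cases F hR hC hi hj with ⟨g₁, g₂, g₃, g₄, g₅⟩ |
      ⟨g₁, g₂, g₃, g₄⟩ | ⟨g₁, g₂, g₃⟩ | ⟨g₁, g₂⟩
    · rw [h₅, g₅]; exact h.col_succ hi g₃
    · have := hmono (show i + 1 ≤ i + 1 + 1 by omega)
      have := entryCol_le_succ R C F (i + 1)
      omega
    · omega
    · rw [h₅, g₂]
      have : F i (j + 1) ≠ F (i + 1) j := fun heq => by
        have := h.inj hi' h₃ hi hj heq
        omega
      omega
    · rw [h₄, g₅]; exact h.row_succ hi g₃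
    · rw [h₄, g₄]; exact h.col_succ g₁ hj
    · rw [h₄, g₃, h0]; have := h.upper hi hj; omega
    · have := entryCol_le_succ R C F (i + 1)
      omega
    · omega
    · omega
    · omega
    · omega
    · rw [h₂, g₅]
      exact (h.col_succ hi hj).trans (h.row_succ hi g₃)
    · rw [h₂, g₄]
      exact (h.col_succ hi hj).trans (h.col_succ g₁ hj)
    · rw [h₂, g₃, h0]; have := h.upper hi' hj; omega
    · rw [h₂, g₂]; exact h.col_succ hi hj

theorem IsStd.iterate_gromotion {R C : ℕ} {F : ℕ → ℕ → ℕ} (h : IsStd R C 0 F) (hR : 0 < R)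
    (hC : 0 < C) (k : ℕ) : IsStd R C k ((PromRS.gromotion R C)^[k] F) := by
  induction k with
  | zero => exact h
  | succ k ih =>
    rw [Function.iterate_succ_apply']
    exact ih.gromotion hR hC

/-! ### Gromotion preserves the sizes of chains -/

/-- `ρ` sends every entry of the `R × C` filling `F` to its row. -/
def IsRowFun (R C : ℕ) (F : ℕ → ℕ → ℕ) (ρ : ℕ → ℤ) : Prop :=
  ∀ {i j}, i < R → j < C → ρ (F i j) = i

theorem IsStd.exists_cell {R C k : ℕ} {F : ℕ → ℕ → ℕ} (h : IsStd R C k F) :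
    ∃ f : ℕ → ℕ × ℕ, ∀ {i j}, i < R → j < C → f (F i j) = (i, j) := by
  classical
  refine ⟨fun v => if hv : ∃ p : ℕ × ℕ, p.1 < R ∧ p.2 < C ∧ F p.1 p.2 = v then hv.choose
    else (0, 0), ?_⟩
  intro i j hi hj
  have hv : ∃ p : ℕ × ℕ, p.1 < R ∧ p.2 < C ∧ F p.1 p.2 = F i j := ⟨(i, j), hi, hj, rfl⟩
  dsimp only
  rw [dif_pos hv]
  obtain ⟨h₁, h₂, h₃⟩ := hv.choose_spec
  exact Prod.ext_iff.2 (h.inj h₁ h₂ hi hj h₃)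

theorem IsStd.exists_isRowFun {R C k : ℕ} {F : ℕ → ℕ → ℕ} (h : IsStd R C k F) :
    ∃ ρ, IsRowFun R C F ρ := by
  obtain ⟨f, hf⟩ := h.exists_cell
  exact ⟨fun v => (f v).1, fun hi hj => by simp [hf hi hj]⟩

/-- `ρ` sends every entry of `F` to its row at the time when, during a gromotion, entries have
already slid up out of the rows `1, …, s`, but not yet out of row `s + 1`. -/
def IsRowFunAt (R C : ℕ) (F : ℕ → ℕ → ℕ) (s : ℕ) (ρ : ℕ → ℤ) : Prop :=
  ∀ {i j}, i < R → j < C →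
    ρ (F i j) = if 1 ≤ i ∧ i ≤ s ∧ j = entryCol R C F i then (i : ℤ) - 1 else i

section

variable {R C k : ℕ} {F : ℕ → ℕ → ℕ}

/-- A single entry sliding up preserves the sizes of chains among the labels of an interval. -/
theorem hasChains_iff_of_slide_up (h : IsStd R C k F) {lo hi s i N : ℕ} (hlo : k + 1 ≤ lo)
    (hhi : hi ≤ k + R * C) (hs : s + 1 < R) (hC : 0 < C) {ρ ρ' : ℕ → ℤ}
    (hρ : IsRowFunAt R C F s ρ) (hρ' : IsRowFunAt R C F (s + 1) ρ') :
    HasChains (Finset.Ioc lo hi) ρ i N ↔ HasChains (Finset.Ioc lo hi) ρ' i N := by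
  classical
  obtain ⟨hle, hdown⟩ := entryCol_succ_mem R C F s
  have hvC := entryCol_lt (R := R) (F := F) hC (s + 1)
  have hright := fun j => right_of_lt_entryCol (R := R) (C := C) (F := F) (s := s) (j := j)
  have hu0 : s = 0 → entryCol R C F s = 0 := by rintro rfl; rfl
  have h0 := h.entry_zero (by omega) hC
  generalize hu : entryCol R C F s = u at *
  generalize hv : entryCol R C F (s + 1) = v at *
  have hcell : ∀ z ∈ Finset.Ioc lo hi, ∃ a < R, ∃ j < C, F a j = z := fun z hz => by
    rw [Finset.mem_Ioc] at hz
    exact h.surj z (by omega) (by omega)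
  have hx : ρ (F (s + 1) v) = ((s + 1 : ℕ) : ℤ) := by
    rw [hρ hs hvC, if_neg (by omega)]
  have hx' : ρ' (F (s + 1) v) = s := by
    rw [hρ' hs hvC, if_pos (by omega)]
    push_cast
    ring
  have hoff : ∀ z ∈ Finset.Ioc lo hi, z ≠ F (s + 1) v → ρ' z = ρ z := by
    intro z hz hne
    obtain ⟨a, ha, j, hj, rfl⟩ := hcell z hz
    rw [hρ ha hj, hρ' ha hj]
    by_cases h₁ : a = s + 1
    · subst h₁
      have h₂ : j ≠ v := by rintro rfl; exact hne rfl
      rw [if_neg (by rw [hv]; omega), if_neg (by omega)]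
    · congr 1
      exact propext ⟨fun h => ⟨h.1, by omega, h.2.2⟩, fun h => ⟨h.1, by omega, h.2.2⟩⟩
  have hrow : ∀ {j}, j < C → j ≠ u → ρ (F s j) = s := fun {j} hj hne => by
    rw [hρ (by omega) hj, if_neg (by rw [hu]; omega)]
  have hrow' : ∀ {j}, j < C → ρ (F (s + 1) j) = ((s + 1 : ℕ) : ℤ) := fun {j} hj => by
    rw [hρ hs hj, if_neg (by omega)]
  -- the entries of rows `s` and `s + 1` among the labels
  have hmem : ∀ z ∈ Finset.Ioc lo hi, ρ z = s → ∃ j < C, j ≠ u ∧ F s j = z := by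
    intro z hz hz'
    obtain ⟨a, ha, j, hj, rfl⟩ := hcell z hz
    have h₁ := hρ ha hj
    rw [hz'] at h₁
    split_ifs at h₁ with h₂
    · omega
    · obtain rfl : s = a := by omega
      refine ⟨j, hj, ?_, rfl⟩
      rintro rfl
      rw [hu] at h₂
      have hs0 : s = 0 := by omega
      rw [hs0, hu0 hs0, h0, Finset.mem_Ioc] at hz
      omega
  have hmem' : ∀ z ∈ Finset.Ioc lo hi, ρ z = ((s + 1 : ℕ) : ℤ) → ∃ j < C, F (s + 1) j = z := by
    intro z hz hz'
    obtain ⟨a, ha, j, hj, rfl⟩ := hcell z hz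
    have h₁ := hρ ha hj
    rw [hz'] at h₁
    split_ifs at h₁ with h₂
    · omega
    · obtain rfl : s + 1 = a := by omega
      exact ⟨j, hj, rfl⟩
  have hcast : ((s + 1 : ℕ) : ℤ) - 1 = s := by push_cast; ring
  by_cases hxI : F (s + 1) v ∈ Finset.Ioc lo hi
  swap
  · have : ∀ z ∈ Finset.Ioc lo hi, ρ z = ρ' z := fun z hz =>
      (hoff z hz (by rintro rfl; exact hxI hz)).symm
    exact ⟨fun h => h.congr this, fun h => h.congr fun z hz => (this z hz).symm⟩
  have hupd : ∀ z ∈ Finset.Ioc lo hi, Function.update ρ (F (s + 1) v) (s : ℤ) z = ρ' z := by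
    intro z hz
    by_cases hne : z = F (s + 1) v
    · rw [hne, Function.update_self, hx']
    · rw [Function.update_of_ne hne, hoff z hz hne]
  rw [Finset.mem_Ioc] at hxI
  constructor
  · intro hch
    refine (hch.lower (ρ' := Function.update ρ (F (s + 1) v) (s : ℤ)) hx
      (by rw [Function.update_self, hcast]) (fun z hz => Function.update_of_ne hz _ _) ?_).congr
      hupd
    intro y hy hyx _
    rw [hcast]
    rw [Finset.mem_Ioc] at hy
    set A := (Finset.range C).filter fun j => j ≠ u ∧ y ≤ F s j ∧ F s j < F (s + 1) v with hA
    have h₁ : ((Finset.Ioc lo hi).filter fun z => (y ≤ z ∧ z < F (s + 1) v) ∧ ρ z = s) ⊆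
        A.image (F s) := by
      intro z hz
      rw [Finset.mem_filter] at hz
      obtain ⟨j, hj, hju, rfl⟩ := hmem z hz.1 hz.2.2
      refine Finset.mem_image_of_mem _ ?_
      rw [hA, Finset.mem_filter, Finset.mem_range]
      exact ⟨hj, hju, hz.2.1⟩
    refine (Finset.card_le_card h₁).trans (Finset.card_image_le.trans ?_)
    -- entries of row `s` to the left of its empty cell are sent to the entry below, the others
    -- to the entry below their left neighbour
    have hlt : ∀ j ∈ A, (if j < u then j else j - 1) < v ∧
        F s j < F (s + 1) (if j < u then j else j - 1) := by
      intro j hj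
      rw [hA, Finset.mem_filter, Finset.mem_range] at hj
      obtain ⟨hj, hju, h₂, h₃⟩ := hj
      have h₄ : j ≤ v := by
        by_contra! hvj
        have h₅ := (hdown (by omega)).2
        have h₆ := h.row_le (i := s) (by omega) (show v + 1 ≤ j from hvj) hj
        omega
      split_ifs with h₅
      · exact ⟨by omega, h.col_succ hs hj⟩
      · have h₆ := (hright (j - 1) (by omega) (by omega)).2
        rw [Nat.sub_add_cancel (by omega)] at h₆
        have h₇ : F s j ≠ F (s + 1) (j - 1) := fun heq => by
          have := h.inj (by omega) hj hs (by omega) heq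
          omega
        exact ⟨by omega, by omega⟩
    refine Finset.card_le_card_of_injOn (fun j => F (s + 1) (if j < u then j else j - 1)) ?_ ?_
    · intro j hjA
      obtain ⟨h₂, h₃⟩ := hlt j hjA
      rw [Finset.mem_coe, hA, Finset.mem_filter] at hjA
      rw [Finset.mem_coe, Finset.mem_filter, Finset.mem_Ioc]
      have h₄ := h.row_lt hs h₂ hvC
      dsimp only
      exact ⟨by omega, by omega, hrow' (by omega)⟩
    · intro j hj j' hj' heq
      have h₂ := (hlt j hj).1
      have h₂' := (hlt j' hj').1
      have h₃ := (h.inj hs (by omega) hs (by omega) heq).2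
      rw [Finset.mem_coe, hA, Finset.mem_filter] at hj hj'
      split_ifs at h₃ <;> omega
  · intro hch
    refine HasChains.raise (ρ' := Function.update ρ (F (s + 1) v) (s : ℤ)) hx
      (by rw [Function.update_self, hcast]) (fun z hz => Function.update_of_ne hz _ _) ?_
      (hch.congr fun z hz => (hupd z hz).symm)
    intro y hy hyx _
    rw [hcast]
    rw [Finset.mem_Ioc] at hy
    set A := (Finset.range C).filter fun j => F (s + 1) v < F (s + 1) j ∧ F (s + 1) j ≤ y with hA
    have h₁ : ((Finset.Ioc lo hi).filter fun z => (F (s + 1) v < z ∧ z ≤ y) ∧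
        ρ z = ((s + 1 : ℕ) : ℤ)) ⊆ A.image (F (s + 1)) := by
      intro z hz
      rw [Finset.mem_filter] at hz
      obtain ⟨j, hj, rfl⟩ := hmem' z hz.1 hz.2.2
      refine Finset.mem_image_of_mem _ ?_
      rw [hA, Finset.mem_filter, Finset.mem_range]
      exact ⟨hj, hz.2.1⟩
    refine (Finset.card_le_card h₁).trans (Finset.card_image_le.trans ?_)
    refine Finset.card_le_card_of_injOn (F s) ?_ ?_
    · intro j hj
      rw [Finset.mem_coe, hA, Finset.mem_filter, Finset.mem_range] at hj
      obtain ⟨hj, h₂, h₃⟩ := hj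
      have h₄ : v < j := by
        by_contra! hjv
        have := h.row_le hs hjv hvC
        omega
      have h₅ := (hdown (by omega)).2
      have h₆ := h.row_le (i := s) (by omega) (show v + 1 ≤ j from h₄) hj
      have h₇ := h.col_succ hs hj
      rw [Finset.mem_coe, Finset.mem_filter, Finset.mem_Ioc]
      exact ⟨by omega, by omega, hrow hj (by omega)⟩
    · intro j hj j' hj' heq
      rw [Finset.mem_coe, hA, Finset.mem_filter, Finset.mem_range] at hj hj'
      exact (h.inj (by omega) hj.1 (by omega) hj'.1 heq).2

/-- Gromotion preserves the sizes of chains among the labels of an interval. -/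
theorem hasChains_gromotion_iff (h : IsStd R C k F) (hR : 0 < R) (hC : 0 < C) {lo hi i N : ℕ}
    (hlo : k + 1 ≤ lo) (hhi : hi ≤ k + R * C) {ρ ρ' : ℕ → ℤ} (hρ : IsRowFun R C F ρ)
    (hρ' : IsRowFun R C (gromotion R C F) ρ') :
    HasChains (Finset.Ioc lo hi) ρ i N ↔ HasChains (Finset.Ioc lo hi) ρ' i N := by
  classical
  set σ : ℕ → ℕ → ℤ := fun s z =>
    if ∃ t < R, 1 ≤ t ∧ t ≤ s ∧ z = F t (entryCol R C F t) then ρ z - 1 else ρ z with hσ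
  have hσAt : ∀ s, IsRowFunAt R C F s (σ s) := by
    intro s i j hi hj
    have hiff : (∃ t < R, 1 ≤ t ∧ t ≤ s ∧ F i j = F t (entryCol R C F t)) ↔
        1 ≤ i ∧ i ≤ s ∧ j = entryCol R C F i := by
      constructor
      · rintro ⟨t, ht, h₁, h₂, h₃⟩
        obtain ⟨rfl, h₄⟩ := h.inj hi hj ht (entryCol_lt hC t) h₃
        exact ⟨h₁, h₂, h₄⟩
      · rintro ⟨h₁, h₂, h₃⟩
        exact ⟨i, hi, h₁, h₂, by rw [← h₃]⟩
    simp only [hσ, hiff, hρ hi hj]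
  have hσs : ∀ s < R, (HasChains (Finset.Ioc lo hi) ρ i N ↔
      HasChains (Finset.Ioc lo hi) (σ s) i N) := by
    intro s
    induction s with
    | zero =>
      intro _
      have : σ 0 = ρ := by
        funext z
        simp only [hσ]
        rw [if_neg]
        rintro ⟨t, _, h₁, h₂, _⟩
        omega
      rw [this]
    | succ s ih =>
      intro hs
      exact (ih (by omega)).trans
        (hasChains_iff_of_slide_up h hlo hhi hs hC (hσAt s) (hσAt (s + 1)))
  have hfin : ∀ z ∈ Finset.Ioc lo hi, σ (R - 1) z = ρ' z := by
    intro z hz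
    rw [Finset.mem_Ioc] at hz
    obtain ⟨i, hi, j, hj, rfl⟩ := (h.gromotion hR hC).surj z (by omega) (by omega)
    rw [hρ' hi hj]
    rcases gromotion_cases F hR hC hi hj with ⟨h₁, h₂, h₃, h₄, h₅⟩ | ⟨h₁, h₂, h₃, h₄⟩ |
      ⟨h₁, h₂, h₃⟩ | ⟨h₁, h₂⟩
    · rw [h₅, hσAt _ hi h₃, if_neg (by omega)]
    · rw [h₄, hσAt _ h₁ hj, if_pos (by omega)]
      push_cast
      ring
    · have := h.entry_zero hR hC
      omega
    · rw [h₂, hσAt _ hi hj, if_neg]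
      rintro ⟨-, -, rfl⟩
      exact h₁ ⟨le_rfl, entryCol_le_succ R C F i⟩
  rw [hσs (R - 1) (by omega)]
  exact ⟨fun h => h.congr hfin, fun h => h.congr fun z hz => (hfin z hz).symm⟩

theorem hasChains_iterate_gromotion_iff (h : IsStd R C 0 F) (hR : 0 < R) (hC : 0 < C)
    {k hi i N : ℕ} (hhi : hi ≤ R * C) {ρ ρ' : ℕ → ℤ} (hρ : IsRowFun R C F ρ)
    (hρ' : IsRowFun R C ((gromotion R C)^[k] F) ρ') :
    HasChains (Finset.Ioc k hi) ρ i N ↔ HasChains (Finset.Ioc k hi) ρ' i N := by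
  suffices key : ∀ m ≤ k, ∀ {ρ' : ℕ → ℤ}, IsRowFun R C ((gromotion R C)^[m] F) ρ' →
      (HasChains (Finset.Ioc k hi) ρ i N ↔ HasChains (Finset.Ioc k hi) ρ' i N) from
    key k le_rfl hρ'
  intro m
  induction m with
  | zero =>
    intro _ ρ' hρ'
    have : ∀ z ∈ Finset.Ioc k hi, ρ z = ρ' z := by
      intro z hz
      rw [Finset.mem_Ioc] at hz
      obtain ⟨i, hi, j, hj, rfl⟩ := h.surj z (by omega) (by omega)
      rw [hρ hi hj]
      exact (hρ' hi hj).symm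
    exact ⟨fun h => h.congr this, fun h => h.congr fun z hz => (this z hz).symm⟩
  | succ m ih =>
    intro hm ρ'' hρ''
    have hstd := h.iterate_gromotion hR hC m
    obtain ⟨ρm, hρm⟩ := hstd.exists_isRowFun
    rw [Function.iterate_succ_apply'] at hρ''
    exact (ih (by omega) hρm).trans
      (hasChains_gromotion_iff hstd hR hC (by omega) (by omega) hρm hρ'')

end

/-! ### The shape of a gromoted stack -/

/-- The shape of a filling `F` obtained from `stack P Q` by at most `r * c` gromotions: in
column `j`, the entries of `P` that are left occupy the `t j` topmost cells, followed by column
`j` of `Q`, and then by new labels. -/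
structure IsStackShape {r c : ℕ} (Q : RectSYT r c) (F : ℕ → ℕ → ℕ) (t : ℕ → ℕ) : Prop where
  le : ∀ {j}, j < c → t j ≤ r
  anti : ∀ {j j'}, j ≤ j' → j' < c → t j' ≤ t j
  top : ∀ {i j}, i < t j → j < c → F i j ≤ r * c
  mid : ∀ {i j}, i < r → j < c → F (t j + i) j = Q.entry i j + r * c
  bot : ∀ {i j}, t j + r ≤ i → i < 2 * r → j < c → 2 * (r * c) < F i j

section

variable {r c : ℕ} {P Q : RectSYT r c} {F : ℕ → ℕ → ℕ} {t : ℕ → ℕ}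

theorem isStackShape_stack (P Q : RectSYT r c) :
    IsStackShape Q (P.stack Q).entry (fun _ => r) where
  le _ := le_rfl
  anti _ _ := le_rfl
  top {i j} hi hj := by
    have := P.isStd.upper hi hj
    simp only [RectSYT.stack, hi, if_true]
    omega
  mid {i j} hi hj := by
    have h₁ : ¬ r + i < r := by omega
    have h₂ : r + i < 2 * r := by omega
    simp only [RectSYT.stack, h₁, h₂, hj, if_false, if_true, and_self]
    rw [Nat.add_sub_cancel_left]
  bot h₁ h₂ _ := by omega

theorem IsStackShape.lt_iff (h : IsStackShape Q F t) {i j : ℕ} (hi : i < 2 * r) (hj : j < c) :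
    r * c < F i j ↔ t j ≤ i := by
  constructor
  · intro h₁
    by_contra! h₂
    have := h.top h₂ hj
    omega
  · intro h₁
    by_cases h₂ : i < t j + r
    · have h₃ := h.mid (i := i - t j) (by omega) hj
      rw [Nat.add_sub_cancel' h₁] at h₃
      have := Q.isStd.lower (i := i - t j) (by omega) hj
      omega
    · have := h.bot (by omega) hi hj
      omega

/-- In the part of the filling that comes from `Q`, the slides go down. -/
theorem IsStackShape.down_lt (h : IsStackShape Q F t) {i j : ℕ} (hi : i < r) (hj : j + 1 < c)
    (ht : t (j + 1) < t j) : F (t j + i) j < F (t j + i - 1) (j + 1) := by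
  have htr := h.le (show j < c by omega)
  rw [h.mid hi (by omega)]
  have hup := Q.isStd.upper hi (show j < c by omega)
  by_cases h₁ : t j + i - 1 - t (j + 1) < r
  · have h₂ := h.mid h₁ hj
    rw [Nat.add_sub_cancel' (by omega)] at h₂
    rw [h₂]
    have h₃ := Q.isStd.row_succ hi hj
    have h₄ := Q.isStd.col_le (show i ≤ t j + i - 1 - t (j + 1) by omega) h₁ hj
    omega
  · have := h.bot (i := t j + i - 1) (j := j + 1) (by omega) (by omega) hj
    omega

/-- One gromotion of a filling as above: the empty cell leaves the entries of `P` at the bottom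
of some column `j`, and then slides straight down through column `j` of `Q`. -/
theorem IsStackShape.exists_gromotion {k : ℕ} (h : IsStackShape Q F t)
    (hF : IsStd (2 * r) c k F) (hk : k < r * c) :
    ∃ j < c, 0 < t j ∧
      IsStackShape Q (gromotion (2 * r) c F) (Function.update t j (t j - 1)) ∧
      slideInto (2 * r) c F r = Q.entry (r - t j) j + r * c := by
  classical
  have hr : 0 < r := Nat.pos_of_ne_zero (by rintro rfl; simp at hk)
  have hc : 0 < c := Nat.pos_of_ne_zero (by rintro rfl; simp at hk)
  have hF0 := hF.entry_zero (by omega) hc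
  have hec := fun s => entryCol_lt (R := 2 * r) (F := F) hc s
  have hmono := entryCol_mono (2 * r) c F
  have hdown := fun s => (entryCol_succ_mem (2 * r) c F s).2
  have hright := fun s j => right_of_lt_entryCol (R := 2 * r) (C := c) (F := F) (s := s) (j := j)
  have he0 : entryCol (2 * r) c F 0 = 0 := rfl
  have hcases := fun i j => gromotion_cases (R := 2 * r) (i := i) (j := j) F (by omega) hc
  have hgdown := fun i => gromotion_down (R := 2 * r) (F := F) (i := i) hc
  have hinto := slideInto_eq (R := 2 * r) (F := F) (i := r) hc (by omega)
  generalize entryCol (2 * r) c F = e at *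
  -- `i₀` is the last row in which the empty cell is among the entries of `P`
  obtain ⟨i₀, hi₀r, hi₀, hi₀'⟩ : ∃ i₀ < r, F i₀ (e i₀) ≤ r * c ∧
      r * c < F (i₀ + 1) (e (i₀ + 1)) := by
    have hex : ∃ s, s < 2 * r ∧ r * c < F s (e s) :=
      ⟨r, by omega, (h.lt_iff (by omega) (hec r)).2 (h.le (hec r))⟩
    have h₁ := Nat.find_spec hex
    have h₂ : Nat.find hex ≤ r := Nat.find_min' hex
      ⟨by omega, (h.lt_iff (by omega) (hec r)).2 (h.le (hec r))⟩
    have h₃ : Nat.find hex ≠ 0 := fun h₃ => by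
      rw [h₃, he0, hF0] at h₁
      omega
    obtain ⟨s, hs⟩ := Nat.exists_eq_succ_of_ne_zero h₃
    have h₄ := Nat.find_min hex (m := s) (by omega)
    rw [hs] at h₁
    refine ⟨s, by omega, ?_, h₁.2⟩
    by_contra! h₅
    exact h₄ ⟨by omega, h₅⟩
  -- a slide to the right from an entry of `P` arrives at an entry of `P`
  have hstay : ∀ i j, i < r → i < t j → e i ≤ j → j < e (i + 1) → i < t (j + 1) := by
    intro i j hi hij h₁ h₂
    obtain ⟨h₃, h₄⟩ := hright i j h₁ h₂
    by_contra! h₅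
    refine h₄ ⟨by omega, ?_⟩
    by_cases h₆ : i + 1 < t j
    · have h₇ := h.top h₆ (by omega)
      have h₈ := (h.lt_iff (i := i) (by omega) h₃).2 h₅
      omega
    · have h₇ : t j = i + 1 := by omega
      have := h.down_lt hr h₃ (by omega)
      rwa [h₇, Nat.add_zero, Nat.add_sub_cancel] at this
  obtain ⟨j₀, hj₀⟩ : ∃ j₀, j₀ = e (i₀ + 1) := ⟨_, rfl⟩
  have hj₀c : j₀ < c := hj₀ ▸ hec _
  have htop : i₀ < t j₀ := by
    have key : ∀ j, e i₀ ≤ j → j ≤ j₀ → i₀ < t j := by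
      intro j hj
      induction j, hj using Nat.le_induction with
      | base =>
        intro _
        by_contra! h₁
        have := (h.lt_iff (by omega) (hec i₀)).2 h₁
        omega
      | succ j hj ih =>
        intro h₁
        exact hstay i₀ j hi₀r (ih (by omega)) hj (by omega)
    exact key j₀ (hj₀ ▸ hmono (Nat.le_succ _)) le_rfl
  have ht₀ : t j₀ = i₀ + 1 := by
    rw [← hj₀] at hi₀'
    have := (h.lt_iff (by omega) hj₀c).1 hi₀'
    omega
  have hnext : j₀ + 1 < c → t (j₀ + 1) ≤ i₀ := by
    intro h₁
    have h₂ := (hdown i₀ (by omega)).2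
    rw [← hj₀] at h₂ hi₀'
    exact (h.lt_iff (by omega) h₁).1 (by omega)
  -- the empty cell slides straight down
  have hstraight : ∀ s, 1 ≤ s → s ≤ r → e (i₀ + s) = j₀ := by
    intro s hs
    induction s, hs using Nat.le_induction with
    | base => exact fun _ => hj₀.symm
    | succ s hs ih =>
      intro hsr
      have h₁ := ih (by omega)
      have h₂ := hmono (show i₀ + s ≤ i₀ + (s + 1) by omega)
      by_contra h₃
      obtain ⟨h₄, h₅⟩ := hright (i₀ + s) j₀ h₁.le (by rw [← Nat.add_assoc] at h₂ h₃; omega)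
      refine h₅ ⟨by omega, ?_⟩
      have h₆ := h.down_lt (i := s) (by omega) h₄ (by have := hnext h₄; omega)
      rwa [ht₀, show i₀ + 1 + s = i₀ + s + 1 by ring, Nat.add_sub_cancel] at h₆
  obtain ⟨t', ht'⟩ : ∃ t', t' = Function.update t j₀ (t j₀ - 1) := ⟨_, rfl⟩
  have ht'₀ : t' j₀ = i₀ := by rw [ht', Function.update_self, ht₀, Nat.add_sub_cancel]
  have ht'ne : ∀ j, j ≠ j₀ → t' j = t j := fun j hj => by rw [ht', Function.update_of_ne hj]
  have ht'le : ∀ j, t' j ≤ t j ∧ t j ≤ t' j + 1 := by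
    intro j
    by_cases hj : j = j₀
    · subst hj
      omega
    · rw [ht'ne j hj]
      omega
  have hafter : ∀ j, j₀ < j → j < c → t j ≤ i₀ := fun j h₁ h₂ =>
    (h.anti (show j₀ + 1 ≤ j from h₁) h₂).trans (hnext (by omega))
  refine ⟨j₀, hj₀c, by omega, ?_, ?_⟩
  · rw [← ht']
    refine ⟨fun hj => (ht'le _).1.trans (h.le hj), ?_, ?_, ?_, ?_⟩
    · intro j j' hjj hj'
      have h₁ := h.anti hjj hj'
      have h₂ := ht'le j'
      by_cases h₃ : j = j₀
      · subst h₃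
        rcases hjj.eq_or_lt with rfl | h₄
        · exact le_rfl
        · have := hafter j' h₄ hj'
          omega
      · rw [ht'ne j h₃]
        omega
    · intro i j hi hj
      have hir := h.le hj
      have h' := ht'le j
      rcases hcases i j (by omega) hj with ⟨h₁, h₂, h₃, h₄, h₅⟩ | ⟨h₁, h₂, h₃, h₄⟩ |
        ⟨h₁, h₂, h₃⟩ | ⟨h₁, h₂⟩
      · rw [h₅]
        exact h.top (hstay i j (by omega) (by omega) h₁ h₂) h₃
      · rw [h₄]
        refine h.top ?_ hj
        by_contra! h₅
        have h₆ : r * c < F (i + 1) (e (i + 1)) := by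
          rw [← h₂]
          exact (h.lt_iff h₁ hj).2 h₅
        have h₇ : F i (e i) ≤ r * c :=
          (hF.row_le (by omega) (h₂ ▸ hmono (Nat.le_succ i)) hj).trans (h.top (by omega) hj)
        rcases lt_trichotomy i i₀ with h₈ | rfl | h₈
        · have := hF.le (show i + 1 ≤ i₀ from h₈) (by omega) (hmono (show i + 1 ≤ i₀ from h₈)) (hec i₀)
          omega
        · rw [← hj₀] at h₂
          subst h₂
          omega
        · have := hF.le (show i₀ + 1 ≤ i from h₈) (by omega) (hmono (show i₀ + 1 ≤ i from h₈)) (hec i)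
          omega
      · omega
      · rw [h₂]
        exact h.top (by omega) hj
    · intro i j hi hj
      by_cases h₁ : j = j₀
      · subst h₁
        have h₂ := hstraight (i + 1) (by omega) (by omega)
        have h₃ := hgdown (i₀ + i) (by omega)
        rw [← Nat.add_assoc] at h₂
        rw [h₂] at h₃
        rw [ht'₀, h₃, ← h.mid hi hj, ht₀]
        congr 1
        ring
      · rw [ht'ne j h₁, ← h.mid hi hj]
        have hir := h.le hj
        rcases hcases (t j + i) j (by omega) hj with ⟨h₂, h₃, -⟩ | ⟨-, h₃, -⟩ |
          ⟨h₂, h₃, -⟩ | ⟨-, h₂⟩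
        · exfalso
          by_cases h₄ : t j + i ≤ i₀
          · have h₅ := hmono (show t j + i + 1 ≤ i₀ + 1 by omega)
            have := h.anti (show j ≤ j₀ by omega) hj₀c
            omega
          · have h₅ := hmono (show i₀ + 1 ≤ t j + i by omega)
            have h₆ := hafter j (by omega) hj
            have h₇ := hstraight (t j + i + 1 - i₀) (by omega) (by omega)
            rw [Nat.add_sub_cancel' (by omega)] at h₇
            omega
        · exfalso
          by_cases h₄ : t j + i ≤ i₀
          · have h₅ := hmono (show t j + i + 1 ≤ i₀ + 1 by omega)
            have := h.anti (show j ≤ j₀ by omega) hj₀c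
            omega
          · have h₅ := hmono (show i₀ + 1 ≤ t j + i + 1 by omega)
            have h₆ := hafter j (by omega) hj
            have h₇ := hstraight (t j + i + 1 - i₀) (by omega) (by omega)
            rw [Nat.add_sub_cancel' (by omega)] at h₇
            omega
        · have := hafter j (by omega) hj
          omega
        · exact h₂
    · intro i j hi hi2 hj
      have h' := ht'le j
      rcases hcases i j (by omega) hj with ⟨h₁, h₂, h₃, h₄, h₅⟩ | ⟨h₁, h₂, h₃, h₄⟩ |
        ⟨h₁, h₂, h₃⟩ | ⟨h₁, h₂⟩
      · rw [h₅]
        refine h.bot ?_ hi2 h₃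
        by_cases h₆ : j = j₀
        · subst h₆
          have := hnext h₃
          omega
        · have := h.anti (show j ≤ j + 1 by omega) h₃
          rw [ht'ne j h₆] at hi
          omega
      · rw [h₄]
        exact h.bot (by omega) h₁ hj
      · rw [h₃, hF0, Nat.mul_assoc]
        omega
      · rw [h₂]
        refine h.bot ?_ hi2 hj
        by_contra! h₃
        have h₄ : j = j₀ := by
          by_contra h₄
          rw [ht'ne j h₄] at hi
          omega
        subst h₄
        have h₅ : i = i₀ + r := by omega
        have h₆ := hstraight r hr le_rfl
        rw [← h₅] at h₆
        exact h₁ ⟨h₆.le, h₆ ▸ hmono (Nat.le_succ i)⟩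
  · have h₁ := hstraight (r - i₀) (by omega) (by omega)
    rw [Nat.add_sub_cancel' (by omega)] at h₁
    rw [hinto, h₁, ← h.mid (by omega) hj₀c]
    congr 1
    omega

end

/-! ### The column lengths of what is left of `P` -/

section

variable {R C k : ℕ} {F : ℕ → ℕ → ℕ}

/-- The columns of a standard filling, cut down to a set `I` of labels, are chains. -/
theorem hasChains_columns (h : IsStd R C k F) {I B : Finset ℕ} {ρ : ℕ → ℤ}
    (hρ : IsRowFun R C F ρ) (hB : B ⊆ Finset.range C) :
    HasChains I ρ B.card (∑ b ∈ B, ((Finset.range R).filter fun a => F a b ∈ I).card) := by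
  classical
  obtain ⟨f, hf⟩ := h.exists_cell
  obtain ⟨g, hg, hgB⟩ : ∃ g : ℕ → ℕ, (∀ b ∈ B, g b < B.card) ∧ Set.InjOn g B := by
    refine ⟨fun b => if hb : b ∈ B then B.equivFin ⟨b, hb⟩ else 0, fun b hb => ?_, ?_⟩
    · dsimp only
      rw [dif_pos hb]
      exact Fin.is_lt _
    · intro b hb b' hb' heq
      rw [Finset.mem_coe] at hb hb'
      dsimp only at heq
      rw [dif_pos hb, dif_pos hb'] at heq
      simpa using B.equivFin.injective (Fin.ext heq)
  have hBC : ∀ b ∈ B, b < C := fun b hb => Finset.mem_range.1 (hB hb)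
  set U := B.biUnion fun b => ((Finset.range R).filter fun a => F a b ∈ I).image fun a => F a b
    with hU
  have hmem : ∀ u ∈ U, ∃ b ∈ B, ∃ a < R, F a b ∈ I ∧ F a b = u := by
    intro u hu
    rw [hU, Finset.mem_biUnion] at hu
    obtain ⟨b, hb, hu⟩ := hu
    obtain ⟨a, ha, rfl⟩ := Finset.mem_image.1 hu
    rw [Finset.mem_filter, Finset.mem_range] at ha
    exact ⟨b, hb, a, ha.1, ha.2, rfl⟩
  refine ⟨U, fun u => g (f u).2, ?_, ?_, ?_, ?_⟩
  · intro u hu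
    obtain ⟨b, hb, a, ha, hI, rfl⟩ := hmem u hu
    exact hI
  · rw [hU, Finset.card_biUnion]
    · refine Finset.sum_congr rfl fun b hb => Finset.card_image_of_injOn ?_
      intro a ha a' ha' heq
      rw [Finset.mem_coe, Finset.mem_filter, Finset.mem_range] at ha ha'
      exact (h.inj ha.1 (hBC b hb) ha'.1 (hBC b hb) heq).1
    · intro b hb b' hb' hne
      rw [Function.onFun, Finset.disjoint_left]
      intro u hu hu'
      obtain ⟨a, ha, rfl⟩ := Finset.mem_image.1 hu
      obtain ⟨a', ha', heq⟩ := Finset.mem_image.1 hu'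
      rw [Finset.mem_filter, Finset.mem_range] at ha ha'
      exact hne (h.inj ha'.1 (hBC b' hb') ha.1 (hBC b hb) heq).2.symm
  · intro u hu
    obtain ⟨b, hb, a, ha, hI, rfl⟩ := hmem u hu
    simp only [hf ha (hBC b hb)]
    exact hg b hb
  · intro u hu u' hu' hlt heq
    obtain ⟨b, hb, a, ha, hI, rfl⟩ := hmem u hu
    obtain ⟨b', hb', a', ha', hI', rfl⟩ := hmem u' hu'
    simp only [hf ha (hBC b hb), hf ha' (hBC b' hb')] at heq
    obtain rfl := hgB hb hb' heq
    rw [hρ ha (hBC b hb), hρ ha' (hBC b hb)]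
    by_contra! hle
    have := h.col_le (show a' ≤ a by omega) ha (hBC b hb)
    omega

/-- If `B` is a set of columns such that every row of `F` either has all its entries in the
columns `B` among the labels `I`, or has no entry outside of the columns `B` among the labels
`I`, then no `B.card` chains are larger than the columns `B`. -/
theorem HasChains.le_columns (h : IsStd R C k F) {lo hi i N : ℕ} {B : Finset ℕ}
    {ρ : ℕ → ℤ} (hρ : IsRowFun R C F ρ) (hB : B.card = i) (hlo : k ≤ lo) (hhi : hi ≤ k + R * C)
    (hrow : ∀ a < R, (∀ b ∈ B, F a b ∈ Finset.Ioc lo hi) ∨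
      ∀ b < C, F a b ∈ Finset.Ioc lo hi → b ∈ B)
    (hch : HasChains (Finset.Ioc lo hi) ρ i N) :
    N ≤ ∑ b ∈ B, ((Finset.range R).filter fun a => F a b ∈ Finset.Ioc lo hi).card := by
  classical
  subst hB
  have hcell : ∀ z ∈ Finset.Ioc lo hi, ∃ a < R, ∃ j < C, F a j = z := fun z hz => by
    rw [Finset.mem_Ioc] at hz
    exact h.surj z (by omega) (by omega)
  refine (hch.le_sum (R := R) fun x hx => ?_).trans ?_
  · obtain ⟨a, ha, j, hj, rfl⟩ := hcell x hx
    exact ⟨a, ha, hρ ha hj⟩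
  · simp only [Finset.card_filter (p := fun a => F a _ ∈ Finset.Ioc lo hi)]
    rw [Finset.sum_comm]
    refine Finset.sum_le_sum fun a ha => ?_
    rw [Finset.mem_range] at ha
    rw [← Finset.card_filter]
    rcases hrow a ha with h₁ | h₁
    · rw [Finset.filter_true_of_mem h₁]
      exact min_le_left _ _
    · refine (min_le_right _ _).trans ?_
      refine (Finset.card_le_card ?_).trans (Finset.card_image_le (f := F a))
      intro x hx
      rw [Finset.mem_filter] at hx
      obtain ⟨a', ha', j, hj, rfl⟩ := hcell x hx.1
      obtain rfl : a' = a := by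
        have := hρ ha' hj
        omega
      refine Finset.mem_image_of_mem _ ?_
      rw [Finset.mem_filter]
      exact ⟨h₁ j hj hx.1, hx.1⟩

end

/-- After `k` gromotions of `stack P Q`, the entries of `P` that are left form a shape whose
column lengths, from left to right, are those of the part of `P` with entries greater than `k`,
from right to left: by the invariance of chains, any number of columns on the left of the one
and on the right of the other shape have the same total size. -/
theorem IsStackShape.eq_card {r c k : ℕ} {P Q : RectSYT r c} {t : ℕ → ℕ} (hr : 0 < r)
    (h : IsStackShape Q ((gromotion (2 * r) c)^[k] (P.stack Q).entry) t) {j : ℕ} (hj : j < c) :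
    t j = ((Finset.range r).filter fun a => k < P.entry a (c - 1 - j)).card := by
  classical
  have hc : 0 < c := by omega
  have hS := (P.stack Q).isStd
  have hF := hS.iterate_gromotion (by omega) hc k
  obtain ⟨ρ, hρ⟩ := hS.exists_isRowFun
  obtain ⟨ρ', hρ'⟩ := hF.exists_isRowFun
  have hn : r * c ≤ 2 * r * c := by nlinarith
  have hiff := fun i N => hasChains_iterate_gromotion_iff (i := i) (N := N) hS (by omega) hc hn
    hρ hρ'
  generalize (gromotion (2 * r) c)^[k] (P.stack Q).entry = F at *
  have hFI : ∀ a < 2 * r, ∀ b < c, (F a b ∈ Finset.Ioc k (r * c) ↔ a < t b) := by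
    intro a ha b hb
    have h₁ := hF.lower ha hb
    have h₂ := h.lt_iff ha hb
    rw [Finset.mem_Ioc]
    omega
  have hSI : ∀ a < 2 * r, ∀ b < c, ((P.stack Q).entry a b ∈ Finset.Ioc k (r * c) ↔
      a < r ∧ k < P.entry a b) := by
    intro a ha b hb
    have h₂ := (isStackShape_stack P Q).lt_iff ha hb
    rw [Finset.mem_Ioc]
    by_cases har : a < r
    · have h₃ : (P.stack Q).entry a b = P.entry a b := by simp only [RectSYT.stack, har, if_true]
      rw [h₃] at h₂ ⊢
      omega
    · omega
  have hFcard : ∀ b < c, ((Finset.range (2 * r)).filter fun a =>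
      F a b ∈ Finset.Ioc k (r * c)).card = t b := by
    intro b hb
    have hle := h.le hb
    have : ((Finset.range (2 * r)).filter fun a => F a b ∈ Finset.Ioc k (r * c)) =
        Finset.range (t b) := by
      ext a
      rw [Finset.mem_filter, Finset.mem_range, Finset.mem_range]
      exact ⟨fun ⟨h₁, h₂⟩ => (hFI a h₁ b hb).1 h₂,
        fun h₁ => ⟨by omega, (hFI a (by omega) b hb).2 h₁⟩⟩
    rw [this, Finset.card_range]
  have hScard : ∀ b < c, ((Finset.range (2 * r)).filter fun a =>
      (P.stack Q).entry a b ∈ Finset.Ioc k (r * c)).card =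
      ((Finset.range r).filter fun a => k < P.entry a b).card := by
    intro b hb
    congr 1
    ext a
    rw [Finset.mem_filter, Finset.mem_range, Finset.mem_filter, Finset.mem_range]
    exact ⟨fun ⟨h₁, h₂⟩ => (hSI a h₁ b hb).1 h₂,
      fun h₁ => ⟨by omega, (hSI a (by omega) b hb).2 h₁⟩⟩
  have hsum : ∀ i ≤ c, ∑ b ∈ Finset.range i, t b = ∑ b ∈ Finset.Ico (c - i) c,
      ((Finset.range r).filter fun a => k < P.entry a b).card := by
    intro i hi
    have hB : Finset.range i ⊆ Finset.range c := Finset.range_subset_range.2 hi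
    have hB' : Finset.Ico (c - i) c ⊆ Finset.range c := fun b hb => by
      rw [Finset.mem_Ico] at hb
      exact Finset.mem_range.2 hb.2
    have hcard : (Finset.Ico (c - i) c).card = i := by
      rw [Nat.card_Ico]
      omega
    have e₁ : ∑ b ∈ Finset.range i, ((Finset.range (2 * r)).filter fun a =>
        F a b ∈ Finset.Ioc k (r * c)).card = ∑ b ∈ Finset.range i, t b :=
      Finset.sum_congr rfl fun b hb => hFcard b (Finset.mem_range.1 (hB hb))
    have e₂ : ∑ b ∈ Finset.Ico (c - i) c, ((Finset.range (2 * r)).filter fun a =>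
        (P.stack Q).entry a b ∈ Finset.Ioc k (r * c)).card = ∑ b ∈ Finset.Ico (c - i) c,
        ((Finset.range r).filter fun a => k < P.entry a b).card :=
      Finset.sum_congr rfl fun b hb => hScard b (Finset.mem_range.1 (hB' hb))
    have c₁ := hasChains_columns (I := Finset.Ioc k (r * c)) hF hρ' hB
    have c₂ := hasChains_columns (I := Finset.Ioc k (r * c)) hS hρ hB'
    rw [Finset.card_range, e₁, ← hiff] at c₁
    rw [hcard, e₂, hiff] at c₂
    refine le_antisymm ?_ ?_
    · rw [← e₂]
      refine c₁.le_columns hS hρ hcard (Nat.zero_le k) (by omega) fun a ha => ?_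
      by_contra! hcon
      obtain ⟨⟨b, hb, h₁⟩, b', hb', h₂, h₃⟩ := hcon
      rw [Finset.mem_Ico] at hb h₃
      rw [hSI a ha b hb.2] at h₁
      rw [hSI a ha b' hb'] at h₂
      have := P.isStd.row_le h₂.1 (show b' ≤ b by omega) hb.2
      exact h₁ ⟨h₂.1, by omega⟩
    · rw [← e₁]
      refine c₂.le_columns hF hρ' (Finset.card_range i) le_rfl (by omega) fun a ha => ?_
      by_contra! hcon
      obtain ⟨⟨b, hb, h₁⟩, b', hb', h₂, h₃⟩ := hcon
      rw [Finset.mem_range] at hb h₃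
      rw [hFI a ha b (by omega)] at h₁
      rw [hFI a ha b' hb'] at h₂
      have := h.anti (show b ≤ b' by omega) hb'
      omega
  have h₁ := hsum (j + 1) hj
  have h₂ := hsum j hj.le
  rw [Finset.sum_range_succ, h₂, Finset.sum_eq_sum_Ico_succ_bot (show c - (j + 1) < c by omega),
    show c - (j + 1) + 1 = c - j by omega, show c - (j + 1) = c - 1 - j by omega] at h₁
  omega

/-! ### The promotion permutation of a stack -/

theorem exists_isStackShape {r c : ℕ} (P Q : RectSYT r c) {k : ℕ} (hk : k ≤ r * c) :
    ∃ t, IsStackShape Q ((gromotion (2 * r) c)^[k] (P.stack Q).entry) t := by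
  induction k with
  | zero => exact ⟨_, isStackShape_stack P Q⟩
  | succ k ih =>
    obtain ⟨t, ht⟩ := ih (by omega)
    have hr : 0 < r := Nat.pos_of_ne_zero (by rintro rfl; simp at hk)
    have hc : 0 < c := Nat.pos_of_ne_zero (by rintro rfl; simp at hk)
    obtain ⟨j, _, _, h, _⟩ := ht.exists_gromotion
      ((P.stack Q).isStd.iterate_gromotion (by omega) hc k) hk
    rw [Function.iterate_succ_apply']
    exact ⟨_, h⟩

/-- The promotion permutation sends the entry of `P` in a cell to the entry of `Q` in the cell
that is its mirror image within the same row. -/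
theorem promNE_stack {r c : ℕ} (P Q : RectSYT r c) {i j : ℕ} (hi : i < r) (hj : j < c) :
    (P.stack Q).promNE r (P.entry i j) = Q.entry i (c - 1 - j) := by
  classical
  have hlow := P.isStd.lower hi hj
  have hup := P.isStd.upper hi hj
  obtain ⟨k, hk⟩ : ∃ k, P.entry i j = k + 1 := ⟨P.entry i j - 1, by omega⟩
  obtain ⟨t, ht⟩ := exists_isStackShape P Q (k := k) (by omega)
  obtain ⟨j₀, hj₀, ht₀, hsucc, hinto⟩ := ht.exists_gromotion
    ((P.stack Q).isStd.iterate_gromotion (by omega) (by omega) k) (by omega)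
  rw [← Function.iterate_succ_apply' (f := gromotion (2 * r) c)] at hsucc
  have h₁ := ht.eq_card (by omega) hj₀
  have h₂ := hsucc.eq_card (by omega) hj₀
  rw [Function.update_self] at h₂
  -- the column in which the number of entries of `P` drops contains the entry `k + 1`
  obtain ⟨a, ha, hak⟩ : ∃ a < r, P.entry a (c - 1 - j₀) = k + 1 := by
    by_contra! hcon
    have : ((Finset.range r).filter fun a => k < P.entry a (c - 1 - j₀)) =
        (Finset.range r).filter fun a => k.succ < P.entry a (c - 1 - j₀) := by
      refine Finset.filter_congr fun a ha => ?_
      have := hcon a (Finset.mem_range.1 ha)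
      omega
    rw [this] at h₁
    omega
  obtain ⟨rfl, hjj⟩ := P.isStd.inj ha (by omega) hi hj (hak.trans hk.symm)
  rw [hjj] at h₁
  have hset : ((Finset.range r).filter fun b => k < P.entry b j) = Finset.Ico a r := by
    ext b
    rw [Finset.mem_filter, Finset.mem_range, Finset.mem_Ico]
    constructor
    · rintro ⟨hb, hkb⟩
      refine ⟨?_, hb⟩
      by_contra! hba
      have := P.isStd.col_lt hba ha hj
      omega
    · rintro ⟨hab, hb⟩
      have := P.isStd.col_le hab hb hj
      exact ⟨hb, by omega⟩
  rw [hset, Nat.card_Ico] at h₁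
  rw [h₁, show r - (r - a) = a by omega, show j₀ = c - 1 - j by omega] at hinto
  have hQl := Q.isStd.lower ha (show c - 1 - j < c by omega)
  have hQu := Q.isStd.upper ha (show c - 1 - j < c by omega)
  have hn : 2 * r * c = r * c + r * c := by ring
  rw [RectSYT.promNE, RectSYT.prom, hk, Nat.add_sub_cancel, hinto, residue,
    Nat.mod_eq_of_lt (by omega)]
  push_cast
  omega

/-- The permutation of `{0, …, r * c - 1}` which sends `P.entry i j - 1` to
`Q.entry i (c - 1 - j) - 1`. -/
theorem exists_mirrorPerm {r c : ℕ} (P Q : RectSYT r c) :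
    ∃ σ : Equiv.Perm (Fin (r * c)), ∀ i j (m : Fin (r * c)), i < r → j < c →
      P.entry i j = m + 1 → (σ m : ℕ) + 1 = Q.entry i (c - 1 - j) := by
  have hcell : ∀ m : Fin (r * c), ∃ p : ℕ × ℕ, p.1 < r ∧ p.2 < c ∧ P.entry p.1 p.2 = m + 1 := by
    intro m
    obtain ⟨i, hi, j, hj, h⟩ := P.isStd.surj (m + 1) (by omega) (by omega)
    exact ⟨(i, j), hi, hj, h⟩
  choose f hfr hfc hf using hcell
  have hb : ∀ m, 0 < Q.entry (f m).1 (c - 1 - (f m).2) ∧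
      Q.entry (f m).1 (c - 1 - (f m).2) ≤ r * c := fun m => by
    have h₁ := hfc m
    have h₂ := Q.isStd.upper (hfr m) (show c - 1 - (f m).2 < c by omega)
    exact ⟨Q.isStd.lower (hfr m) (by omega), by omega⟩
  set g : Fin (r * c) → Fin (r * c) := fun m =>
    ⟨Q.entry (f m).1 (c - 1 - (f m).2) - 1, by have := hb m; omega⟩ with hg
  have hinj : Function.Injective g := by
    intro m m' h
    have h₁ := Fin.mk.inj_iff.1 h
    have h₂ := hb m
    have h₃ := hb m'
    have h₄ := hfc m
    have h₅ := hfc m'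
    have h₆ := Q.isStd.inj (hfr m) (by omega) (hfr m') (by omega)
      (show Q.entry (f m).1 (c - 1 - (f m).2) = Q.entry (f m').1 (c - 1 - (f m').2) by omega)
    have h₇ := hf m
    rw [h₆.1, show (f m).2 = (f m').2 by omega, hf m'] at h₇
    exact Fin.ext (by omega)
  refine ⟨Equiv.ofBijective g (Finite.injective_iff_bijective.1 hinj), ?_⟩
  intro i j m hi hj hm
  obtain ⟨h₁, h₂⟩ := P.isStd.inj (hfr m) (hfc m) hi hj ((hf m).trans hm.symm)
  have := hb m
  rw [Equiv.ofBijective_apply, hg]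
  dsimp only
  rw [← h₁, ← h₂]
  omega

/-! ### Robinson–Schensted of the mirror permutation -/

/-- The insertion and recording tableaux of the first `k` letters of a word `w`. -/
def rsState (w : ℕ → ℕ) : ℕ → List (List ℕ) × List (List ℕ)
  | 0 => ([], [])
  | k + 1 => ((tabInsert (w k) (rsState w k).1).1,
      appendAt (k + 1) (tabInsert (w k) (rsState w k).1).2 (rsState w k).2)

/-- The one-line notation of a permutation of `{0, …, n - 1}`, with values shifted to
`{1, …, n}`, and with `0` as a junk value after the end. -/
def permWord {n : ℕ} (σ : Equiv.Perm (Fin n)) : ℕ → ℕ :=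
  fun j => if h : j < n then (σ ⟨j, h⟩ : ℕ) + 1 else 0

theorem permWord_coe {n : ℕ} (σ : Equiv.Perm (Fin n)) (j : Fin n) :
    permWord σ j = (σ j : ℕ) + 1 := by
  simp [permWord]

theorem RSRows_eq {n : ℕ} (σ : Equiv.Perm (Fin n)) : RSRows σ = rsState (permWord σ) n := by
  have h₁ : RSRows σ = (List.range n).foldl (fun PQ j =>
      ((tabInsert (permWord σ j) PQ.1).1,
        appendAt (j + 1) (tabInsert (permWord σ j) PQ.1).2 PQ.2)) ([], []) := by
    rw [← List.map_coe_finRange_eq_range, List.foldl_map]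
    simp only [permWord_coe]
    rfl
  rw [h₁]
  generalize permWord σ = w
  clear h₁ σ
  induction n with
  | zero => rfl
  | succ n ih => rw [List.range_succ, List.foldl_append, ih]; rfl

/-- The tableau with `L` rows, of which row `s` is `A s 0, …, A s (l s - 1)`. -/
def rowsOf (L : ℕ) (l : ℕ → ℕ) (A : ℕ → ℕ → ℕ) : List (List ℕ) :=
  (List.range L).map fun s => (List.range (l s)).map (A s)

theorem rowsOf_succ (L : ℕ) (l : ℕ → ℕ) (A : ℕ → ℕ → ℕ) :
    rowsOf (L + 1) l A = (List.range (l 0)).map (A 0) ::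
      rowsOf L (fun s => l (s + 1)) (fun s => A (s + 1)) := by
  simp [rowsOf, List.range_succ_eq_map, Function.comp_def]

theorem rowsOf_congr {L : ℕ} {l l' : ℕ → ℕ} {A A' : ℕ → ℕ → ℕ} (hl : ∀ s < L, l s = l' s)
    (hA : ∀ s < L, ∀ a < l s, A s a = A' s a) : rowsOf L l A = rowsOf L l' A' := by
  refine List.map_congr_left fun s hs => ?_
  rw [List.mem_range] at hs
  rw [← hl s hs]
  exact List.map_congr_left fun a ha => hA s hs a (List.mem_range.1 ha)

theorem ofRows_rowsOf (L : ℕ) (l : ℕ → ℕ) (A : ℕ → ℕ → ℕ) (s a : ℕ) :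
    ofRows (rowsOf L l A) s a = if s < L ∧ a < l s then A s a else 0 := by
  by_cases hs : s < L
  · by_cases ha : a < l s
    · simp [ofRows, rowsOf, List.getD_eq_getElem?_getD, hs, ha]
    · simp [ofRows, rowsOf, List.getD_eq_getElem?_getD, hs, ha]
  · simp [ofRows, rowsOf, List.getD_eq_getElem?_getD, hs]

theorem rowInsert_append {x : ℕ} {row : List ℕ} (h : ∀ y ∈ row, y ≤ x) :
    rowInsert x row = (row ++ [x], none) := by
  induction row with
  | nil => rfl
  | cons y ys ih =>
    rw [rowInsert, if_neg (by have := h y (by simp); omega),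
      ih fun z hz => h z (List.mem_cons_of_mem _ hz)]
    rfl

theorem rowInsert_range {x : ℕ} : ∀ {l i : ℕ} {A : ℕ → ℕ}, i < l → (∀ a < i, A a ≤ x) →
    x < A i → rowInsert x ((List.range l).map A) =
      ((List.range l).map (Function.update A i x), some (A i)) := by
  intro l
  induction l with
  | zero => intro i A hi; omega
  | succ l ih =>
    intro i A hi hle hlt
    rw [List.range_succ_eq_map, List.map_cons, List.map_cons, List.map_map, List.map_map,
      rowInsert]
    cases i with
    | zero =>
      rw [if_pos hlt, Function.update_self]
      congr 2
    | succ i =>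
      have h0 := hle 0 (by omega)
      rw [if_neg (by omega), ih (i := i) (A := A ∘ Nat.succ) (by omega)
        (fun a ha => hle (a + 1) (by omega)) hlt]
      simp only [Function.comp_apply, Nat.succ_eq_add_one]
      congr 2
      refine List.map_congr_left fun a _ => ?_
      simp [Function.update_apply]

/-- Insertion into a tableau when all bumps happen in column `i`: row `s < b` receives `v s` and
passes on `v (s + 1)`, and row `b` receives `v b` at its end. -/
theorem tabInsert_rowsOf : ∀ {b L i : ℕ} {l : ℕ → ℕ} {A : ℕ → ℕ → ℕ} {v : ℕ → ℕ}, b ≤ L →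
    (∀ s < b, i < l s) → l b = i → (b = L → i = 0) →
    (∀ s ≤ b, ∀ a < i, A s a ≤ v s) → (∀ s < b, v s < A s i ∧ A s i = v (s + 1)) →
    tabInsert (v 0) (rowsOf L l A) = (rowsOf (max L (b + 1)) (Function.update l b (i + 1))
      (fun s a => if a = i ∧ s ≤ b then v s else A s a), b) := by
  intro b
  induction b with
  | zero =>
    intro L i l A v _ _ hl hL hle _
    cases L with
    | zero =>
      obtain rfl := hL rfl
      simp [rowsOf, tabInsert]
    | succ L =>
      rw [rowsOf_succ, tabInsert, rowInsert_append]
      · rw [max_eq_left (by omega), rowsOf_succ, hl]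
        simp only [Function.update_self]
        rw [List.range_succ, List.map_append]
        congr 2
        · congr 1
          · refine List.map_congr_left fun a ha => ?_
            rw [List.mem_range] at ha
            rw [if_neg (by omega)]
          · simp
        · exact rowsOf_congr (fun s _ => by simp) fun s _ a _ => by simp
      · intro y hy
        obtain ⟨a, ha, rfl⟩ := List.mem_map.1 hy
        rw [List.mem_range] at ha
        exact hle 0 le_rfl a (by omega)
  | succ b ih =>
    intro L i l A v hb hi hl hL hle hlt
    obtain ⟨L, rfl⟩ : ∃ L', L = L' + 1 := ⟨L - 1, by omega⟩
    have h0 := hlt 0 (by omega)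
    rw [rowsOf_succ, tabInsert, rowInsert_range (hi 0 (by omega)) (hle 0 (by omega)) h0.1]
    simp only
    rw [h0.2, ih (v := fun s => v (s + 1)) (by omega) (fun s hs => hi (s + 1) (by omega)) hl
      (fun h => hL (by omega)) (fun s hs => hle (s + 1) (by omega))
      (fun s hs => hlt (s + 1) (by omega))]
    rw [show max (L + 1) (b + 1 + 1) = max L (b + 1) + 1 by omega, rowsOf_succ]
    congr 2
    · rw [Function.update_of_ne (by omega)]
      refine List.map_congr_left fun a _ => ?_
      simp [Function.update_apply]
    · exact rowsOf_congr (fun s _ => by simp [Function.update_apply]) fun s _ a _ => by simp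

theorem appendAt_rowsOf {k : ℕ} : ∀ {b L : ℕ} {l : ℕ → ℕ} {A : ℕ → ℕ → ℕ}, b ≤ L →
    (b = L → l b = 0) → A b (l b) = k →
    appendAt k b (rowsOf L l A) = rowsOf (max L (b + 1)) (Function.update l b (l b + 1)) A := by
  intro b
  induction b with
  | zero =>
    intro L l A _ hL hA
    cases L with
    | zero =>
      have h0 := hL rfl
      rw [h0] at hA
      simp [rowsOf, appendAt, h0, hA]
    | succ L =>
      rw [rowsOf_succ, appendAt, max_eq_left (by omega), rowsOf_succ]
      simp [List.range_succ, hA]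
  | succ b ih =>
    intro L l A hb hL hA
    obtain ⟨L, rfl⟩ : ∃ L', L = L' + 1 := ⟨L - 1, by omega⟩
    rw [rowsOf_succ, appendAt, ih (by omega) (fun h => hL (by omega)) hA,
      show max (L + 1) (b + 1 + 1) = max L (b + 1) + 1 by omega, rowsOf_succ]
    congr 2
    funext s
    simp [Function.update_apply]

theorem card_filter_range_eq {m n : ℕ} {p : ℕ → Prop} [DecidablePred p] (hm : m ≤ n)
    (h : ∀ a < n, p a ↔ a < m) : ((Finset.range n).filter p).card = m := by
  have : (Finset.range n).filter p = Finset.range m := by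
    ext a
    rw [Finset.mem_filter, Finset.mem_range, Finset.mem_range]
    exact ⟨fun ⟨h₁, h₂⟩ => (h a h₁).1 h₂, fun h₁ => ⟨by omega, (h a (by omega)).2 h₁⟩⟩
  rw [this, Finset.card_range]

/-- The number of entries at most `k` in row `i` of `T`. -/
def rowLen {r c : ℕ} (T : RectSYT r c) (k i : ℕ) : ℕ :=
  ((Finset.range c).filter fun j => T.entry i j ≤ k).card

theorem rowLen_le {r c : ℕ} (T : RectSYT r c) (k i : ℕ) : rowLen T k i ≤ c :=
  (Finset.card_filter_le _ _).trans (Finset.card_range c).le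

theorem lt_rowLen_iff {r c : ℕ} (T : RectSYT r c) {k i j : ℕ} (hi : i < r) (hj : j < c) :
    j < rowLen T k i ↔ T.entry i j ≤ k := by
  by_cases hall : ∀ j < c, T.entry i j ≤ k
  · have : rowLen T k i = c := card_filter_range_eq le_rfl fun a ha => by simp [ha, hall a ha]
    rw [this]
    simp [hj, hall j hj]
  · push Not at hall
    have h₁ := Nat.find_spec hall
    have : rowLen T k i = Nat.find hall := by
      refine card_filter_range_eq h₁.1.le fun a ha => ⟨fun h => ?_, fun h => ?_⟩
      · by_contra! hle
        have := T.isStd.row_le hi hle ha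
        omega
      · have := Nat.find_min hall h
        by_contra! h'
        exact this ⟨ha, h'⟩
    rw [this]
    constructor
    · intro h
      have := Nat.find_min hall h
      by_contra! h'
      exact this ⟨hj, h'⟩
    · intro h
      by_contra! hle
      have := T.isStd.row_le hi hle hj
      omega

theorem rowLen_of_entry {r c : ℕ} (T : RectSYT r c) {k i j : ℕ} (hi : i < r) (hj : j < c)
    (h : T.entry i j = k + 1) : rowLen T k i = j ∧ rowLen T (k + 1) i = j + 1 := by
  have h₁ := lt_rowLen_iff T (k := k) hi hj
  have h₃ := lt_rowLen_iff T (k := k + 1) hi hj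
  have h₅ := rowLen_le T (k + 1) i
  have h₆ : 0 < j → j - 1 < rowLen T k i := fun h0 => by
    have := T.isStd.row_lt hi (show j - 1 < j by omega) hj
    rw [lt_rowLen_iff T hi (by omega)]
    omega
  have h₇ : j + 1 < c → ¬ j + 1 < rowLen T (k + 1) i := fun h0 => by
    have := T.isStd.row_succ hi h0
    rw [lt_rowLen_iff T hi h0]
    omega
  omega

theorem rowLen_succ_of_ne {r c : ℕ} (T : RectSYT r c) {k i j a : ℕ} (hi : i < r) (hj : j < c)
    (h : T.entry i j = k + 1) (ha : a < r) (hne : a ≠ i) :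
    rowLen T (k + 1) a = rowLen T k a := by
  refine congrArg Finset.card (Finset.filter_congr fun b hb => ?_)
  rw [Finset.mem_range] at hb
  have : T.entry a b ≠ k + 1 := fun h' => hne (T.isStd.inj ha hb hi hj (h'.trans h.symm)).1
  omega

/-- The tableaux of the first `k` letters of the word that has the letter `Q.entry i (c - 1 - j)`
in position `P.entry i j`: the recording tableau is the transpose of the part of `P` with entries
at most `k`, and if row `i` of that part has length `m`, then column `i` of the insertion tableau
consists of the last `m` entries of row `i` of `Q`. The next letter pushes its column down. -/
theorem rsState_mirror {r c : ℕ} (P Q : RectSYT r c) (hr : 0 < r) {w : ℕ → ℕ}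
    (hw : ∀ i j k, i < r → j < c → P.entry i j = k + 1 → w k = Q.entry i (c - 1 - j)) :
    ∀ {k}, k ≤ r * c → rsState w k =
      (rowsOf (rowLen P k 0) (rowLen P.transpose k) fun s i => Q.entry i (c - rowLen P k i + s),
        rowsOf (rowLen P k 0) (rowLen P.transpose k) fun s i => P.entry i s) := by
  intro k
  induction k with
  | zero =>
    intro _
    have : rowLen P 0 0 = 0 := card_filter_range_eq (Nat.zero_le _) fun a ha => by
      have := P.isStd.lower hr ha
      omega
    rw [this]
    rfl
  | succ k ih =>
    intro hk
    obtain ⟨i, hi, b, hb, hib⟩ := P.isStd.surj (k + 1) (by omega) (by omega)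
    have hib' : P.transpose.entry b i = k + 1 := hib
    obtain ⟨hlam, hlam'⟩ := rowLen_of_entry P hi hb hib
    obtain ⟨hl, hl'⟩ := rowLen_of_entry P.transpose hb hi hib'
    have hlamne := fun a => rowLen_succ_of_ne P (a := a) hi hb hib
    have hlne := fun a => rowLen_succ_of_ne P.transpose (a := a) hb hi hib'
    have hlt := fun a s (ha : a < r) (hs : s < c) => lt_rowLen_iff P (k := k) ha hs
    have hlt' := fun s a (hs : s < c) (ha : a < r) => lt_rowLen_iff P.transpose (k := k) hs ha
    have hlamle := fun a => rowLen_le P k a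
    have hrow : ∀ a < i, b < rowLen P k a := fun a ha => by
      have := P.isStd.col_lt ha hi hb
      rw [hlt a b (by omega) hb]
      omega
    have hL : b ≤ rowLen P k 0 ∧ (b = rowLen P k 0 → i = 0) ∧
        rowLen P (k + 1) 0 = max (rowLen P k 0) (b + 1) := by
      rcases Nat.eq_zero_or_pos i with rfl | h0
      · omega
      · have := hrow 0 h0
        have := hlamne 0 hr (by omega)
        omega
    have hins := tabInsert_rowsOf (b := b) (L := rowLen P k 0) (i := i)
      (l := rowLen P.transpose k) (A := fun s i => Q.entry i (c - rowLen P k i + s))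
      (v := fun s => Q.entry i (c - 1 - b + s)) hL.1 (fun s hs => ?_) hl hL.2.1
      (fun s hs a ha => ?_) (fun s hs => ?_)
    rotate_left
    · have := P.isStd.row_lt hi hs hb
      refine (hlt' s i (by omega) hi).2 ?_
      change P.entry i s ≤ k
      omega
    · have := hrow a ha
      exact Q.isStd.le ha.le hi (by omega) (by omega)
    · have := Q.isStd.row_succ hi (j := c - 1 - b + s) (by omega)
      rw [hlam, show c - b + s = c - 1 - b + s + 1 by omega]
      exact ⟨this, congrArg _ (by ring)⟩
    have happ := appendAt_rowsOf (k := k + 1) (b := b) (L := rowLen P k 0)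
      (l := rowLen P.transpose k) (A := fun s i => P.entry i s) hL.1
      (fun h => by rw [hl, hL.2.1 h]) (by rw [hl, hib])
    have hupd : ∀ s < c, Function.update (rowLen P.transpose k) b (i + 1) s =
        rowLen P.transpose (k + 1) s := by
      intro s hs
      rw [Function.update_apply]
      split_ifs with h
      · rw [h, hl']
      · exact (hlne s hs h).symm
    have hLc := rowLen_le P (k + 1) 0
    rw [rsState, ih (by omega), hw i b k hi hb hib]
    dsimp only
    rw [show Q.entry i (c - 1 - b) = Q.entry i (c - 1 - b + 0) from rfl, hins]
    dsimp only
    rw [happ, hl, ← hL.2.2]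
    refine Prod.ext ?_ ?_
    · refine rowsOf_congr (fun s hs => hupd s (by omega)) fun s hs a ha => ?_
      rw [hupd s (by omega)] at ha
      have har := rowLen_le P.transpose (k + 1) s
      by_cases hai : a = i
      · subst hai
        have hsb : s ≤ b := by
          by_contra! hsb
          rw [hlne s (by omega) (by omega)] at ha
          have h₁ := (hlt' s a (by omega) hi).1 ha
          have h₂ := P.isStd.row_lt hi hsb (by omega)
          change P.entry a s ≤ k at h₁
          omega
        rw [if_pos ⟨rfl, hsb⟩, hlam']
        congr 1
        omega
      · rw [if_neg (fun h => hai h.1), hlamne a (by omega) hai]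
    · exact rowsOf_congr (fun s hs => hupd s (by omega)) fun _ _ _ _ => rfl

theorem RS_mirrorPerm {r c : ℕ} (P Q : RectSYT r c) {σ : Equiv.Perm (Fin (r * c))}
    (hσ : ∀ i j (m : Fin (r * c)), i < r → j < c →
      P.entry i j = m + 1 → (σ m : ℕ) + 1 = Q.entry i (c - 1 - j)) :
    RS σ = (Q.transpose.entry, P.transpose.entry) := by
  have hz : ∀ (T : RectSYT r c) (s a : ℕ), ¬ (s < c ∧ a < r) → T.transpose.entry s a = 0 :=
    fun T s a => T.transpose.zeros s a
  rw [RS, RSRows_eq]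
  rcases Nat.eq_zero_or_pos r with hr | hr
  · have h0 : r * c = 0 := by rw [hr, Nat.zero_mul]
    generalize permWord σ = w
    refine Prod.ext ?_ ?_ <;> funext s a
    · rw [h0]
      exact (hz Q s a (by omega)).symm
    · rw [h0]
      exact (hz P s a (by omega)).symm
  have hw : ∀ i j k, i < r → j < c → P.entry i j = k + 1 →
      permWord σ k = Q.entry i (c - 1 - j) := by
    intro i j k hi hj hk
    have hup := P.isStd.upper hi hj
    have := hσ i j ⟨k, by omega⟩ hi hj hk
    rw [← this]
    exact permWord_coe σ ⟨k, by omega⟩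
  rw [rsState_mirror P Q hr hw le_rfl]
  have hlam : ∀ a < r, rowLen P (r * c) a = c := fun a ha =>
    card_filter_range_eq le_rfl fun b hb => by
      have := P.isStd.upper ha hb
      simp only [hb, iff_true]
      omega
  have hl : ∀ s < c, rowLen P.transpose (r * c) s = r := fun s hs =>
    card_filter_range_eq le_rfl fun a ha => by
      have := P.isStd.upper ha hs
      simp only [ha, iff_true]
      change P.entry a s ≤ _
      omega
  refine Prod.ext ?_ ?_ <;> funext s a
  · dsimp only
    rw [ofRows_rowsOf, hlam 0 hr]
    by_cases h : s < c ∧ a < r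
    · rw [if_pos ⟨h.1, by rw [hl s h.1]; exact h.2⟩, hlam a h.2, Nat.sub_self, Nat.zero_add]
      rfl
    · rw [if_neg (fun h' => h ⟨h'.1, by rw [← hl s h'.1]; exact h'.2⟩), hz Q s a h]
  · dsimp only
    rw [ofRows_rowsOf, hlam 0 hr]
    by_cases h : s < c ∧ a < r
    · rw [if_pos ⟨h.1, by rw [hl s h.1]; exact h.2⟩]
      rfl
    · rw [if_neg (fun h' => h ⟨h'.1, by rw [← hl s h'.1]; exact h'.2⟩), hz P s a h]

/-! ### Injectivity of Robinson–Schensted -/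

theorem rowInsert_eq_append {x : ℕ} {row : List ℕ} (h : (rowInsert x row).2 = none) :
    (rowInsert x row).1 = row ++ [x] := by
  induction row with
  | nil => rfl
  | cons y ys ih =>
    rw [rowInsert] at h ⊢
    split_ifs at h ⊢
    rw [ih h]
    rfl

theorem mem_rowInsert_self (x : ℕ) (row : List ℕ) : x ∈ (rowInsert x row).1 := by
  induction row with
  | nil => simp [rowInsert]
  | cons y ys ih =>
    rw [rowInsert]
    split_ifs
    · simp
    · exact List.mem_cons_of_mem _ ih

theorem mem_of_mem_rowInsert {x z : ℕ} {row : List ℕ} (h : z ∈ (rowInsert x row).1) :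
    z = x ∨ z ∈ row := by
  induction row with
  | nil => simpa [rowInsert] using h
  | cons y ys ih =>
    rw [rowInsert] at h
    split_ifs at h
    · rcases List.mem_cons.1 h with h | h
      · exact Or.inl h
      · exact Or.inr (List.mem_cons_of_mem _ h)
    · rcases List.mem_cons.1 h with rfl | h
      · simp
      · rcases ih h with h | h
        · exact Or.inl h
        · exact Or.inr (List.mem_cons_of_mem _ h)

theorem lt_and_mem_of_rowInsert {x y : ℕ} {row : List ℕ} (h : (rowInsert x row).2 = some y) :
    x < y ∧ y ∈ row := by
  induction row with
  | nil => simp [rowInsert] at h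
  | cons z zs ih =>
    rw [rowInsert] at h
    split_ifs at h with hlt
    · simp only [Option.some.injEq] at h
      subst h
      exact ⟨hlt, by simp⟩
    · exact ⟨(ih h).1, List.mem_cons_of_mem _ (ih h).2⟩

theorem pairwise_rowInsert {x : ℕ} {row : List ℕ} (h : row.Pairwise (· ≤ ·)) :
    (rowInsert x row).1.Pairwise (· ≤ ·) := by
  induction row with
  | nil => simp [rowInsert]
  | cons y ys ih =>
    rw [List.pairwise_cons] at h
    rw [rowInsert]
    split_ifs with hlt
    · exact List.pairwise_cons.2 ⟨fun z hz => hlt.le.trans (h.1 z hz), h.2⟩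
    · refine List.pairwise_cons.2 ⟨fun z hz => ?_, ih h.2⟩
      rcases mem_of_mem_rowInsert hz with rfl | hz
      · omega
      · exact h.1 z hz

/-- A bump in a row can be undone. -/
theorem rowInsert_injective : ∀ {row row' : List ℕ} {x x' y : ℕ}, row.Pairwise (· ≤ ·) →
    row'.Pairwise (· ≤ ·) → (rowInsert x row).2 = some y → (rowInsert x' row').2 = some y →
    (rowInsert x row).1 = (rowInsert x' row').1 → x = x' ∧ row = row' := by
  intro row
  induction row with
  | nil => intro row' x x' y _ _ h; simp [rowInsert] at h
  | cons a as ih =>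
    intro row' x x' y hr hr' h h' heq
    cases row' with
    | nil => simp [rowInsert] at h'
    | cons a' as' =>
      rw [List.pairwise_cons] at hr hr'
      rw [rowInsert] at h h' heq
      rw [rowInsert] at heq
      split_ifs at h h' heq with h₁ h₂ h₂
      · simp only [Option.some.injEq, List.cons.injEq] at h h' heq
        exact ⟨heq.1, by rw [h, h', heq.2]⟩
      · -- otherwise `x'` would be an entry to the right of `y` that is smaller than `y`
        simp only [Option.some.injEq, List.cons.injEq] at h heq
        have h₃ := lt_and_mem_of_rowInsert h'
        have h₄ := hr.1 x' (heq.2 ▸ mem_rowInsert_self x' as')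
        omega
      · simp only [Option.some.injEq, List.cons.injEq] at h' heq
        have h₃ := lt_and_mem_of_rowInsert h
        have h₄ := hr'.1 x (heq.2 ▸ mem_rowInsert_self x as)
        omega
      · simp only [List.cons.injEq] at heq
        obtain ⟨rfl, rfl⟩ := ih hr.2 hr'.2 h h' heq.2
        exact ⟨rfl, by rw [heq.1]⟩

theorem tabInsert_cons_none {x : ℕ} {row : List ℕ} {rows : List (List ℕ)}
    (h : (rowInsert x row).2 = none) :
    tabInsert x (row :: rows) = ((row ++ [x]) :: rows, 0) := by
  rw [← rowInsert_eq_append h, tabInsert]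
  split
  · next heq => rw [heq]
  · next heq => rw [heq] at h; simp at h

theorem tabInsert_cons_some {x y : ℕ} {row : List ℕ} {rows : List (List ℕ)}
    (h : (rowInsert x row).2 = some y) :
    tabInsert x (row :: rows) =
      ((rowInsert x row).1 :: (tabInsert y rows).1, (tabInsert y rows).2 + 1) := by
  rw [tabInsert]
  split
  · next heq => rw [heq] at h; simp at h
  · next heq =>
    rw [heq] at h ⊢
    simp only [Option.some.injEq] at h
    rw [h]

/-- A list of rows in which no row is empty, all entries are positive, and every row increases
weakly. -/
def IsRowSorted (T : List (List ℕ)) : Prop :=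
  ∀ row ∈ T, row ≠ [] ∧ row.Pairwise (· ≤ ·) ∧ ∀ z ∈ row, 0 < z

theorem isRowSorted_cons {row : List ℕ} {T : List (List ℕ)} : IsRowSorted (row :: T) ↔
    (row ≠ [] ∧ row.Pairwise (· ≤ ·) ∧ ∀ z ∈ row, 0 < z) ∧ IsRowSorted T :=
  List.forall_mem_cons

theorem IsRowSorted.tabInsert {x : ℕ} {T : List (List ℕ)} (hx : 0 < x) (h : IsRowSorted T) :
    IsRowSorted (tabInsert x T).1 := by
  induction T generalizing x with
  | nil =>
    intro row hrow
    simp only [PromRS.tabInsert, List.mem_singleton] at hrow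
    subst hrow
    simp [hx]
  | cons row rows ih =>
    rw [isRowSorted_cons] at h
    have hrow : (rowInsert x row).1 ≠ [] ∧ (rowInsert x row).1.Pairwise (· ≤ ·) ∧
        ∀ z ∈ (rowInsert x row).1, 0 < z := by
      refine ⟨List.ne_nil_of_mem (mem_rowInsert_self x row), pairwise_rowInsert h.1.2.1, ?_⟩
      intro z hz
      rcases mem_of_mem_rowInsert hz with rfl | hz
      · exact hx
      · exact h.1.2.2 z hz
    cases hins : (rowInsert x row).2 with
    | none =>
      rw [tabInsert_cons_none hins, ← rowInsert_eq_append hins]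
      exact isRowSorted_cons.2 ⟨hrow, h.2⟩
    | some y =>
      rw [tabInsert_cons_some hins]
      have := h.1.2.2 y (lt_and_mem_of_rowInsert hins).2
      exact isRowSorted_cons.2 ⟨hrow, ih this h.2⟩

theorem length_tabInsert (x : ℕ) (T : List (List ℕ)) : (tabInsert x T).2 ≤ T.length ∧
    (tabInsert x T).1.length = max T.length ((tabInsert x T).2 + 1) := by
  induction T generalizing x with
  | nil => simp [tabInsert]
  | cons row rows ih =>
    cases hins : (rowInsert x row).2 with
    | none =>
      rw [tabInsert_cons_none hins]
      simp
    | some y =>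
      rw [tabInsert_cons_some hins]
      have := ih y
      simp only [List.length_cons]
      omega

/-- Insertion can be undone if the row of the new cell is known. -/
theorem tabInsert_injective : ∀ {T T' : List (List ℕ)} {x x' : ℕ}, IsRowSorted T →
    IsRowSorted T' → tabInsert x T = tabInsert x' T' → x = x' ∧ T = T' := by
  have aux : ∀ {row : List ℕ} {rows : List (List ℕ)} {x x' : ℕ}, row ≠ [] →
      tabInsert x (row :: rows) ≠ ([[x']], 0) := by
    intro row rows x x' hrow h
    cases hins : (rowInsert x row).2 with
    | none =>
      rw [tabInsert_cons_none hins] at h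
      simp only [Prod.mk.injEq, List.cons.injEq, and_true] at h
      exact hrow (List.append_inj' (s₂ := []) h.1 rfl).1
    | some y =>
      rw [tabInsert_cons_some hins] at h
      simp at h
  intro T
  induction T with
  | nil =>
    intro T' x x' _ hT' heq
    cases T' with
    | nil => simpa [tabInsert] using heq
    | cons row' rows' => exact absurd heq.symm (aux (hT' row' (by simp)).1)
  | cons row rows ih =>
    intro T' x x' hT hT' heq
    cases T' with
    | nil => exact absurd heq (aux (hT row (by simp)).1)
    | cons row' rows' =>
      rw [isRowSorted_cons] at hT hT'
      cases hins : (rowInsert x row).2 with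
      | none =>
        cases hins' : (rowInsert x' row').2 with
        | none =>
          rw [tabInsert_cons_none hins, tabInsert_cons_none hins'] at heq
          simp only [Prod.mk.injEq, List.cons.injEq, and_true] at heq
          obtain ⟨h₁, h₂⟩ := List.append_inj' heq.1 rfl
          exact ⟨by simpa using h₂, by rw [h₁, heq.2]⟩
        | some y' =>
          rw [tabInsert_cons_none hins, tabInsert_cons_some hins'] at heq
          simp at heq
      | some y =>
        cases hins' : (rowInsert x' row').2 with
        | none =>
          rw [tabInsert_cons_some hins, tabInsert_cons_none hins'] at heq
          simp at heq
        | some y' =>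
          rw [tabInsert_cons_some hins, tabInsert_cons_some hins'] at heq
          simp only [Prod.mk.injEq, List.cons.injEq, Nat.add_right_cancel_iff] at heq
          obtain ⟨rfl, rfl⟩ := ih hT.2 hT'.2 (Prod.ext heq.1.2 heq.2)
          obtain ⟨rfl, rfl⟩ := rowInsert_injective hT.1.2.1 hT'.1.2.1 hins hins' heq.1.1
          exact ⟨rfl, rfl⟩

theorem length_appendAt (k : ℕ) {i : ℕ} {T : List (List ℕ)} (hi : i ≤ T.length) :
    (appendAt k i T).length = max T.length (i + 1) := by
  induction T generalizing i with
  | nil =>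
    obtain rfl : i = 0 := by simpa using hi
    rfl
  | cons row rows ih =>
    cases i with
    | zero => simp [appendAt]
    | succ i =>
      rw [List.length_cons] at hi
      simp only [appendAt, List.length_cons, ih (show i ≤ rows.length by omega)]
      omega

/-- The cell with the entry `k` can be removed if `k` is not an entry of another cell. -/
theorem appendAt_injective {k : ℕ} : ∀ {T T' : List (List ℕ)} {i i' : ℕ}, i ≤ T.length →
    i' ≤ T'.length → (∀ row ∈ T, row ≠ [] ∧ k ∉ row) → (∀ row ∈ T', row ≠ [] ∧ k ∉ row) →
    appendAt k i T = appendAt k i' T' → i = i' ∧ T = T' := by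
  have aux : ∀ {row : List ℕ} {rows : List (List ℕ)} {i : ℕ}, row ≠ [] ∧ k ∉ row →
      appendAt k i (row :: rows) ≠ [[k]] := by
    intro row rows i hrow h
    cases i with
    | zero => simp [appendAt, hrow.1] at h
    | succ i =>
      simp only [appendAt, List.cons.injEq] at h
      exact hrow.2 (by simp [h.1])
  intro T
  induction T with
  | nil =>
    intro T' i i' hi hi' _ hT' heq
    obtain rfl : i = 0 := by simpa using hi
    cases T' with
    | nil => exact ⟨(Nat.le_zero.1 hi').symm, rfl⟩
    | cons row' rows' => exact absurd heq.symm (aux (hT' row' (by simp)))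
  | cons row rows ih =>
    intro T' i i' hi hi' hT hT' heq
    cases T' with
    | nil =>
      obtain rfl : i' = 0 := by simpa using hi'
      exact absurd heq (aux (hT row (by simp)))
    | cons row' rows' =>
      rw [List.forall_mem_cons] at hT hT'
      rw [List.length_cons] at hi hi'
      cases i with
      | zero =>
        cases i' with
        | zero =>
          simp only [appendAt, List.cons.injEq, List.append_cancel_right_eq] at heq
          exact ⟨rfl, by rw [heq.1, heq.2]⟩
        | succ i' =>
          simp only [appendAt, List.cons.injEq] at heq
          exact absurd (by simp [← heq.1]) hT'.1.2
      | succ i =>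
        cases i' with
        | zero =>
          simp only [appendAt, List.cons.injEq] at heq
          exact absurd (by simp [heq.1]) hT.1.2
        | succ i' =>
          simp only [appendAt, List.cons.injEq] at heq
          obtain ⟨rfl, rfl⟩ := ih (by omega) (by omega) hT.2 hT'.2 heq.2
          exact ⟨rfl, by rw [heq.1]⟩

theorem mem_appendAt {k i : ℕ} {T : List (List ℕ)} {p : List ℕ → Prop} (hk : p [k])
    (happ : ∀ row ∈ T, p (row ++ [k])) (hT : ∀ row ∈ T, p row) :
    ∀ row ∈ appendAt k i T, p row := by
  induction T generalizing i with
  | nil => simpa [appendAt] using hk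
  | cons row rows ih =>
    rw [List.forall_mem_cons] at happ hT
    cases i with
    | zero => exact List.forall_mem_cons.2 ⟨happ.1, hT.2⟩
    | succ i => exact List.forall_mem_cons.2 ⟨hT.1, ih happ.2 hT.2⟩

theorem rsState_spec {w : ℕ → ℕ} : ∀ {k : ℕ}, (∀ j < k, 0 < w j) →
    IsRowSorted (rsState w k).1 ∧ (rsState w k).2.length = (rsState w k).1.length ∧
      ∀ row ∈ (rsState w k).2, row ≠ [] ∧ ∀ z ∈ row, 0 < z ∧ z ≤ k := by
  intro k
  induction k with
  | zero => simp [rsState, IsRowSorted]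
  | succ k ih =>
    intro hw
    obtain ⟨h₁, h₂, h₃⟩ := ih fun j hj => hw j (by omega)
    obtain ⟨h₄, h₅⟩ := length_tabInsert (w k) (rsState w k).1
    refine ⟨h₁.tabInsert (hw k (by omega)), ?_, ?_⟩
    · simp only [rsState]
      rw [length_appendAt _ (by omega), h₅, h₂]
    · refine mem_appendAt (by simp) (fun row hrow => ⟨by simp, fun z hz => ?_⟩) fun row hrow =>
        ⟨(h₃ row hrow).1, fun z hz => ?_⟩
      · rcases List.mem_append.1 hz with hz | hz
        · have := (h₃ row hrow).2 z hz
          omega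
        · rw [List.mem_singleton] at hz
          omega
      · have := (h₃ row hrow).2 z hz
        omega

theorem rsState_injective {w w' : ℕ → ℕ} : ∀ {k : ℕ}, (∀ j < k, 0 < w j) →
    (∀ j < k, 0 < w' j) → rsState w k = rsState w' k → ∀ j < k, w j = w' j := by
  intro k
  induction k with
  | zero => intro _ _ _ j hj; omega
  | succ k ih =>
    intro hw hw' heq
    obtain ⟨h₁, h₂, h₃⟩ := rsState_spec (w := w) (k := k) fun j hj => hw j (by omega)
    obtain ⟨h₁', h₂', h₃'⟩ := rsState_spec (w := w') (k := k) fun j hj => hw' j (by omega)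
    have h₄ := (length_tabInsert (w k) (rsState w k).1).1
    have h₄' := (length_tabInsert (w' k) (rsState w' k).1).1
    simp only [rsState, Prod.mk.injEq] at heq
    have hnot : ∀ {w : ℕ → ℕ}, (∀ row ∈ (rsState w k).2, row ≠ [] ∧ ∀ z ∈ row, 0 < z ∧ z ≤ k) →
        ∀ row ∈ (rsState w k).2, row ≠ [] ∧ k + 1 ∉ row := fun h row hrow =>
      ⟨(h row hrow).1, fun hk => by have := (h row hrow).2 _ hk; omega⟩
    obtain ⟨h₅, h₆⟩ := appendAt_injective (by omega) (by omega) (hnot h₃) (hnot h₃') heq.2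
    obtain ⟨h₇, h₈⟩ := tabInsert_injective h₁ h₁' (Prod.ext heq.1 h₅)
    intro j hj
    rcases Nat.lt_succ_iff_lt_or_eq.1 hj with hj | rfl
    · exact ih (fun j hj => hw j (by omega)) (fun j hj => hw' j (by omega))
        (Prod.ext h₈ h₆) j hj
    · exact h₇

theorem eq_of_getD_eq : ∀ {a b : List ℕ}, (∀ z ∈ a, 0 < z) → (∀ z ∈ b, 0 < z) →
    (∀ j, a.getD j 0 = b.getD j 0) → a = b := by
  intro a
  induction a with
  | nil =>
    intro b _ hb h
    cases b with
    | nil => rfl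
    | cons y ys =>
      have h₁ := h 0
      have h₂ := hb y (by simp)
      simp only [List.getD_nil, List.getD_cons_zero] at h₁
      omega
  | cons x xs ih =>
    intro b ha hb h
    cases b with
    | nil =>
      have h₁ := h 0
      have h₂ := ha x (by simp)
      simp only [List.getD_nil, List.getD_cons_zero] at h₁
      omega
    | cons y ys =>
      have h₁ := h 0
      simp only [List.getD_cons_zero] at h₁
      rw [h₁, ih (List.forall_mem_cons.1 ha).2 (List.forall_mem_cons.1 hb).2 fun j => by
        simpa only [List.getD_cons_succ] using h (j + 1)]

theorem ofRows_injective : ∀ {T T' : List (List ℕ)},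
    (∀ row ∈ T, row ≠ [] ∧ ∀ z ∈ row, 0 < z) → (∀ row ∈ T', row ≠ [] ∧ ∀ z ∈ row, 0 < z) →
    ofRows T = ofRows T' → T = T' := by
  intro T
  induction T with
  | nil =>
    intro T' _ hT' h
    cases T' with
    | nil => rfl
    | cons row rows =>
      obtain ⟨h₁, h₂⟩ := hT' row (by simp)
      exact absurd (eq_of_getD_eq h₂ (by simp) fun j => by
        simpa [ofRows] using (congrFun (congrFun h 0) j).symm) h₁
  | cons row rows ih =>
    intro T' hT hT' h
    cases T' with
    | nil =>
      obtain ⟨h₁, h₂⟩ := hT row (by simp)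
      exact absurd (eq_of_getD_eq h₂ (by simp) fun j => by
        simpa [ofRows] using congrFun (congrFun h 0) j) h₁
    | cons row' rows' =>
      rw [List.forall_mem_cons] at hT hT'
      rw [eq_of_getD_eq hT.1.2 hT'.1.2 fun j => by
        simpa [ofRows] using congrFun (congrFun h 0) j, ih hT.2 hT'.2 ?_]
      funext i j
      simpa [ofRows] using congrFun (congrFun h (i + 1)) j

theorem RS_injective {n : ℕ} : Function.Injective (RS (n := n)) := by
  intro σ τ h
  have hpos : ∀ ρ : Equiv.Perm (Fin n), ∀ j < n, 0 < permWord ρ j := fun ρ j hj => by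
    rw [permWord, dif_pos hj]
    omega
  have hspec := fun ρ => rsState_spec (hpos ρ)
  simp only [RS, RSRows_eq, Prod.mk.injEq] at h
  have h₁ := ofRows_injective (fun row hrow => ⟨((hspec σ).1 row hrow).1,
    ((hspec σ).1 row hrow).2.2⟩) (fun row hrow => ⟨((hspec τ).1 row hrow).1,
    ((hspec τ).1 row hrow).2.2⟩) h.1
  have h₂ := ofRows_injective (fun row hrow => ⟨((hspec σ).2.2 row hrow).1,
    fun z hz => (((hspec σ).2.2 row hrow).2 z hz).1⟩) (fun row hrow =>
    ⟨((hspec τ).2.2 row hrow).1, fun z hz => (((hspec τ).2.2 row hrow).2 z hz).1⟩) h.2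
  have h₃ := rsState_injective (hpos σ) (hpos τ) (Prod.ext h₁ h₂)
  ext j
  have := h₃ j j.is_lt
  rw [permWord_coe, permWord_coe] at this
  omega

end PromRS

theorem theorem1p1 (r c : ℕ) (P Q : PromRS.RectSYT r c) :
    ∃ σ : Equiv.Perm (Fin (r * c)),
      (∀ j : Fin (r * c), (P.stack Q).promNE r ((j : ℕ) + 1) = ((σ j : ℕ) : ℤ) + 1) ∧
      ∀ τ : Equiv.Perm (Fin (r * c)),
        PromRS.RS τ = (Q.transpose.entry, P.transpose.entry) ↔ τ = σ := by
  obtain ⟨σ, hσ⟩ := PromRS.exists_mirrorPerm P Q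
  refine ⟨σ, fun m => ?_, fun τ => ?_⟩
  · obtain ⟨i, hi, j, hj, hm⟩ := P.isStd.surj (m + 1) (by omega) (by omega)
    rw [← hm, PromRS.promNE_stack P Q hi hj, ← hσ i j m hi hj hm]
    push_cast
    rfl
  · rw [← PromRS.RS_mirrorPerm P Q hσ]
    exact PromRS.RS_injective.eq_iff
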